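/- Let $n\ge 2$ be an integer and let $G$ be a transitive subgroup of the symmetric group $S_n$. For $X\ge 1$ let $N_n(X;G)$ be the number of isomorphism classes of number fields $K$ with $[K:\mathbb{Q}]=n$, with absolute discriminant satisfying $|\mathrm{Disc}(K)|\le X$, and such that the Galois group $\mathrm{Gal}(\widetilde K/\mathbb{Q})$ of the normal closure $\widetilde K$ of $K/\mathbb{Q}$, acting on the $n$ embeddings $K\hookrightarrow\widetilde K$, is isomorphic to $G$ as a permutation group. For $B\ge 1$ let $P_n(B;G)$ be the number of monic polynomials $f\in\mathbb{Z}[x]$ of degree $n$ whose coefficients are all at most $B$ in absolute value and whose Galois group over $\mathbb{Q}$, acting on the set of complex roots of $f$, is isomorphic to $G$ as a permutation group (so that $f$ has $n$ distinct roots). Let $e>\frac{1}{n^2-n}$ be a real number such that $N_n(X;G)\ll X^e$ for every sufficiently large $X$, with an implied constant depending at most on $G$ and $e$. Then, for all $B\ge 2$, \[ P_n(B;G)\ll B^{e(2n-2)+1}(\log B)^{n-1}. \] If moreover $G$ is primitive, i.e. preserves no nontrivial partition of $\{1,\dots,n\}$, then, for all $B\ge 2$, \[ P_n(B;G)\ll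 B^{e(2n-2)+1-\frac{2}{n}}(\log B)^{n-1}. \] The implied constants do not depend on $B$. -/

import Mathlib

open Polynomial Module

/-- A permutation representation `act` of a group `H` on a set `Ω` is isomorphic, as a permutation
group, to the subgroup `G` of `S_n`: there are a bijection `φ : Ω ≃ {1, …, n}` and a group
isomorphism `ψ : H ≃ G` that intertwine the two actions. -/
def IsPermIsomorphic {n : ℕ} {H Ω : Type*} [Group H] (act : H →* Equiv.Perm Ω)
    (G : Subgroup (Equiv.Perm (Fin n))) : Prop :=
  ∃ (φ : Ω ≃ Fin n) (ψ : H ≃* G), ∀ (σ : H) (ω : Ω),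
    φ (act σ ω) = (ψ σ : Equiv.Perm (Fin n)) (φ ω)

/-- The Galois group of `f` over `ℚ`, acting on the set of its complex roots, is `G`
(as a permutation group). In particular `f` then has `n` distinct complex roots. -/
def PolyHasGaloisGroup {n : ℕ} (f : ℤ[X]) (G : Subgroup (Equiv.Perm (Fin n))) : Prop :=
  haveI : Fact (((f.map (Int.castRingHom ℚ)).map (algebraMap ℚ ℂ)).Splits) :=
    ⟨IsAlgClosed.splits _⟩
  IsPermIsomorphic (Gal.galActionHom (f.map (Int.castRingHom ℚ)) ℂ) G

/-- The monic integer polynomials of degree `n` and height at most `B` with Galois group `G`.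
`Polynomial.supNorm` is the height: the maximum of the absolute values of the coefficients. -/
def galoisPolys (n : ℕ) (G : Subgroup (Equiv.Perm (Fin n))) (B : ℝ) : Set ℤ[X] :=
  {f | f.Monic ∧ f.natDegree = n ∧ f.supNorm ≤ B ∧ PolyHasGaloisGroup f G}

/-- The number `P_n(B; G)`. -/
noncomputable def polyCount (n : ℕ) (G : Subgroup (Equiv.Perm (Fin n))) (B : ℝ) : ℕ :=
  (galoisPolys n G B).ncard

/-- The automorphism group of `L` over `ℚ` acts on the embeddings `K → L` by composition. -/
def embeddingsActionHom (K L : Type*) [Field K] [Field L] [Algebra ℚ K] [Algebra ℚ L] :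
    Gal(L/ℚ) →* Equiv.Perm (K →ₐ[ℚ] L) where
  toFun σ := AlgEquiv.refl.arrowCongr σ
  map_one' := by ext; rfl
  map_mul' _ _ := by ext; rfl

/-- The Galois group of the normal closure `K̃` of `K` over `ℚ`, acting on the set of embeddings
of `K` into `K̃`, is `G` (as a permutation group). -/
def FieldHasGaloisGroup {n : ℕ} (K : IntermediateField ℚ ℂ)
    (G : Subgroup (Equiv.Perm (Fin n))) : Prop :=
  IsPermIsomorphic (embeddingsActionHom K (IntermediateField.normalClosure ℚ K ℂ)) G

/-- The subfields `K` of `ℂ` of degree `n` over `ℚ` whose normal closure has Galois group `G`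
and whose absolute discriminant is at most `X` in absolute value. Every number field is isomorphic
to a subfield of `ℂ`. -/
def galoisFields (n : ℕ) (G : Subgroup (Equiv.Perm (Fin n))) (X : ℝ) :
    Set (IntermediateField ℚ ℂ) :=
  {K | ∃ _ : NumberField K, finrank ℚ K = n ∧ FieldHasGaloisGroup K G ∧
    ((|NumberField.discr K| : ℤ) : ℝ) ≤ X}

/-- Isomorphism of subfields of `ℂ`. -/
def fieldIsoSetoid : Setoid (IntermediateField ℚ ℂ) where
  r K L := Nonempty (K ≃ₐ[ℚ] L)
  iseqv := ⟨fun _ => ⟨AlgEquiv.refl⟩, fun ⟨e⟩ => ⟨e.symm⟩, fun ⟨e⟩ ⟨f⟩ => ⟨e.trans f⟩⟩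

/-- The number `N_n(X; G)` of isomorphism classes of number fields of degree `n` with Galois
group `G` and absolute discriminant at most `X` in absolute value. -/
noncomputable def fieldCount (n : ℕ) (G : Subgroup (Equiv.Perm (Fin n))) (X : ℝ) : ℕ :=
  ((Quotient.mk fieldIsoSetoid) '' galoisFields n G X).ncard

/-- The set counted by `polyCount` is finite. -/
theorem galoisPolys_finite (n : ℕ) (G : Subgroup (Equiv.Perm (Fin n))) (B : ℝ) :
    (galoisPolys n G B).Finite := by
  have hinj : Function.Injective fun f : {f : ℤ[X] // f.natDegree ≤ n} =>
      fun i : Fin (n + 1) => f.1.coeff i := by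
    rintro ⟨f, hf⟩ ⟨g, hg⟩ h
    ext i
    by_cases hi : i < n + 1
    · exact congrFun h ⟨i, hi⟩
    · have hi' : n < i := by omega
      exact (coeff_eq_zero_of_natDegree_lt (hf.trans_lt hi')).trans
        (coeff_eq_zero_of_natDegree_lt (hg.trans_lt hi')).symm
  have hfin : (Set.univ.pi fun _ : Fin (n + 1) => Set.Icc (-⌈B⌉) ⌈B⌉).Finite :=
    Set.Finite.pi fun _ => Set.finite_Icc _ _
  refine ((hfin.preimage hinj.injOn).image Subtype.val).subset ?_
  rintro f ⟨-, hn, hB, -⟩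
  refine ⟨⟨f, hn.le⟩, fun i _ => ?_, rfl⟩
  have h1 : |((f.coeff i : ℤ) : ℝ)| ≤ B := by
    rw [← Int.norm_eq_abs]; exact (f.le_supNorm i).trans hB
  have h2 : |f.coeff i| ≤ ⌈B⌉ := by exact_mod_cast h1.trans (Int.le_ceil B)
  exact abs_le.mp h2

/-- The set counted by `fieldCount` is finite (Hermite). -/
theorem galoisFields_finite (n : ℕ) (G : Subgroup (Equiv.Perm (Fin n))) (X : ℝ) :
    (galoisFields n G X).Finite := by
  refine ((NumberField.finite_of_discr_bdd ℂ ⌈X⌉₊).image Subtype.val).subset ?_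
  rintro K ⟨hK, -, -, hX⟩
  refine ⟨⟨K, hK.to_finiteDimensional⟩, ?_, rfl⟩
  have : ((|NumberField.discr K| : ℤ) : ℝ) ≤ ((⌈X⌉₊ : ℤ) : ℝ) := by
    exact_mod_cast hX.trans (Nat.le_ceil X)
  exact_mod_cast this

/-!
Every `f` counted by `polyCount` is the minimal polynomial of an algebraic integer `x` generating a
field `K` of degree `n` counted by `fieldCount`. The product of `max 1 ‖σ x‖` over the embeddings
`σ` of `K` is the Mahler measure of `f`, which is `O(B)`; comparing `discr K` with the discriminant
of `x` gives `|discr K| = O(B ^ (2 * n - 2))` (`discr_le_of_prod_max_one_le`). So it suffices to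
bound, for each such `K`, the number of integers `x` of `K` of Mahler measure `O(B)`, and then to
sum over the isomorphism classes of the fields `K`.

The integers of Mahler measure `O(B)` lie in `O((log B) ^ (n - 1))` boxes `‖σ x‖ ≤ T σ` with `T σ`
a power of two, `1 ≤ T σ`, and `∏ T σ` a fixed number `P` of size `B` (`card_le_of_forall_box`). All
the bounds in a box come from one pigeonhole argument (`card_le_mul_pow_finrank`): if two points of
the box are congruent modulo `p`, then their difference divided by `p` is an integer of `K` in a
very small box, and a norm, discriminant or determinant inequality says that it is special.
* The norm of a nonzero integer is at least `1`, so each box contains `O(P)` integers.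
* Suppose that `G` is primitive. Then every `x : 𝓞 K` is rational or has distinct conjugates, and
  in the latter case `|discr K| ≤ ∏ ‖σ x - τ x‖` over `σ ≠ τ`
  (`FieldHasGaloisGroup.exists_int_or_injective`, `discr_le_of_norm_sub_le`). Write `b ^ n = P` and
  `d ^ (n * (n - 1)) = |discr K|`. If `b ≤ d` or `n = 2`, the pigeonhole argument is applied to the
  lattice `𝓞 K / ℤ` of rank `n - 1` (`card_le_of_le_discr`). If `d ≤ b` and `3 ≤ n`, the integers in
  a box smaller by a factor of order `d / b` do not span `K` and thus generate a lattice of rank at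
  most `n - 1`, and the pigeonhole argument is applied twice, to `𝓞 K` and to that lattice
  (`card_le_of_discr_le`). In both cases a box contains `O(b ^ n / d)` generators of `K`, that is
  `O(P * |discr K| ^ (-1 / (n ^ 2 - n)))`.

With `θ = 0` or `θ = 1 / (n ^ 2 - n)`, the number of polynomials is therefore at most a constant
times `B * (log B) ^ (n - 1) * ∑ |discr K| ^ (-θ)`. Since `θ < e`, the sum is dominated by its top
dyadic range (`sum_rpow_neg_le`) and is `O((B ^ (2 * n - 2)) ^ (e - θ))`.
-/

/-! ### Lattice points modulo an integer -/

/-- The pigeonhole principle modulo `p`: a free `ℤ`-module of rank at most `r` has at most `p ^ r`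
classes modulo `p`, so if each class meets `s` in at most `k` elements, then `s` has at most
`k * p ^ r` elements. -/
theorem card_le_mul_pow_finrank {M ι : Type*} [AddCommGroup M] [Module.Free ℤ M]
    [Module.Finite ℤ M] {r p k : ℕ} (hr : finrank ℤ M ≤ r) (hp : 0 < p) (s : Finset ι) (f : ι → M)
    (h : ∀ x₀ ∈ s, ∀ u ⊆ s, (∀ x ∈ u, ∃ z, f x - f x₀ = p • z) → u.card ≤ k) :
    s.card ≤ k * p ^ r := by
  classical
  have : NeZero p := ⟨hp.ne'⟩
  let b := Module.finBasis ℤ M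
  let g : ι → Fin (finrank ℤ M) → ZMod p := fun x i => (b.repr (f x) i : ZMod p)
  have key := Finset.card_le_mul_card_image (f := g) s k ?_
  · refine key.trans (Nat.mul_le_mul_left _ ((Finset.card_le_univ _).trans ?_))
    simpa using Nat.pow_le_pow_right hp hr
  · intro a ha
    obtain ⟨x₀, hx₀, rfl⟩ := Finset.mem_image.mp ha
    refine h x₀ hx₀ _ (Finset.filter_subset _ _) fun x hx => ?_
    have hx := (Finset.mem_filter.mp hx).2
    have hd : ∀ i, ∃ c : ℤ, b.repr (f x) i - b.repr (f x₀) i = p * c := fun i => by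
      have := congrFun hx i
      exact (ZMod.intCast_eq_intCast_iff_dvd_sub _ _ _).mp this.symm
    choose c hc using hd
    refine ⟨∑ i, c i • b i, b.repr.injective ?_⟩
    ext i
    simp [hc, Finsupp.single_apply]

/-! ### Norm and discriminant inequalities in a number field -/

section NumberField

open NumberField NumberField.canonicalEmbedding

variable {K : Type*} [Field K] [NumberField K]

/-- The norm of a nonzero algebraic integer has absolute value at least `1`. -/
theorem eq_zero_of_prod_lt_one {T : (K →+* ℂ) → ℝ} (hT : ∏ σ, T σ < 1) {x : 𝓞 K}
    (hx : ∀ σ, ‖σ x‖ ≤ T σ) : x = 0 := by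
  by_contra h
  have h1 : (∏ σ : K →+* ℂ, ‖σ x‖) < 1 :=
    (Finset.prod_le_prod (fun _ _ => norm_nonneg _) fun σ _ => hx σ).trans_lt hT
  have h2 : (∏ σ : K →+* ℂ, ‖σ x‖) = |(Algebra.norm ℤ x : ℝ)| := by
    have h3 := Algebra.norm_eq_prod_embeddings ℚ ℂ (x : K)
    rw [← norm_prod, ← (RingHom.equivRatAlgHom K ℂ).symm.prod_comp]
    have : ((Algebra.norm ℤ x : ℤ) : ℂ) = algebraMap ℚ ℂ (Algebra.norm ℚ (x : K)) := by
      rw [← Algebra.coe_norm_int]; simp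
    rw [← this] at h3
    rw [show (∏ i : K →ₐ[ℚ] ℂ, (RingHom.equivRatAlgHom K ℂ).symm i (x : K)) =
      ∏ i : K →ₐ[ℚ] ℂ, i (x : K) from rfl, ← h3]
    simp
  rw [h2] at h1
  have h4 : |Algebra.norm ℤ x| < 1 := by exact_mod_cast h1
  exact h (Algebra.norm_eq_zero_iff.mp (Int.abs_lt_one_iff.mp h4))

/-- The discriminant of a basis of `K` consisting of integers is `discr K` times the square of a
nonzero integer. -/
theorem discr_le_norm_det_sq {n : ℕ} (e : Fin n ≃ (K →+* ℂ)) (v : Fin n → 𝓞 K)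
    (hv : (Matrix.of fun i j => e i (v j)).det ≠ 0) :
    ((|discr K| : ℤ) : ℝ) ≤ ‖(Matrix.of fun i j => e i (v j)).det‖ ^ 2 := by
  classical
  let ω : Basis (Fin n) ℤ (𝓞 K) := (RingOfIntegers.basis K).reindex
    ((equivReindex K).symm.trans e.symm)
  let W : Matrix (Fin n) (Fin n) ℂ := Matrix.of fun i j => e i (ω j)
  let A : Matrix (Fin n) (Fin n) ℤ := Matrix.of fun i j => ω.repr (v j) i
  have hmul : (Matrix.of fun i j => e i (v j)) = W * A.map (Int.castRingHom ℂ) := by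
    ext i j
    simp only [W, A, Matrix.mul_apply, Matrix.of_apply, Matrix.map_apply, eq_intCast]
    conv_lhs => rw [← ω.sum_repr (v j)]
    simp [mul_comm]
  have hdet : (Matrix.of fun i j => e i (v j)).det = W.det * (A.det : ℂ) := by
    rw [hmul, Matrix.det_mul, ← RingHom.mapMatrix_apply, ← RingHom.map_det]; simp
  have hW : ((discr K : ℤ) : ℂ) = W.det ^ 2 := by
    have hWe : W = ((basisMatrix K).submatrix e e).transpose := by
      ext i j
      simp [W, ω, latticeBasis_apply, integralBasis_apply]
    rw [discr_eq_basisMatrix_det_sq, hWe, Matrix.det_transpose, Matrix.det_submatrix_equiv_self]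
  have hA : (1 : ℝ) ≤ ‖(A.det : ℂ)‖ := by
    have : A.det ≠ 0 := by
      rintro h0
      simp [hdet, h0] at hv
    rw [Complex.norm_intCast]
    exact_mod_cast Int.one_le_abs this
  have : ((|discr K| : ℤ) : ℝ) = ‖W.det‖ ^ 2 := by
    rw [← norm_pow, ← hW, Complex.norm_intCast]; simp
  rw [this, hdet, norm_mul]
  gcongr
  exact le_mul_of_one_le_right (norm_nonneg _) hA

/-- The field discriminant is at most the discriminant of an integral generator, which is the square
of a Vandermonde determinant. -/
theorem discr_le_of_norm_sub_le {n : ℕ} (hn : finrank ℚ K = n) {x : 𝓞 K}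
    (hinj : Function.Injective fun σ : K →+* ℂ => σ x) {T : (K →+* ℂ) → ℝ} (hT : ∀ σ, 0 < T σ)
    {c : ℝ} (h : ∀ σ τ : K →+* ℂ, σ ≠ τ → ‖σ x - τ x‖ ≤ c * (T σ * T τ)) :
    ((|discr K| : ℤ) : ℝ) ≤ c ^ (n * (n - 1)) * (∏ σ, T σ) ^ (2 * (n - 1)) := by
  classical
  have hcard : Fintype.card (K →+* ℂ) = n := by rw [Embeddings.card, hn]
  let e : Fin n ≃ (K →+* ℂ) := (Fintype.equivFinOfCardEq hcard).symm
  have hV : (Matrix.of fun i j : Fin n => e i ((fun j : Fin n => x ^ (j : ℕ)) j : 𝓞 K)) =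
      Matrix.vandermonde fun i => e i x := by
    ext i j; simp [Matrix.vandermonde]
  have h0 : (Matrix.vandermonde fun i => e i x).det ≠ 0 :=
    Matrix.det_vandermonde_ne_zero_iff.mpr (hinj.comp e.injective)
  have h1 := discr_le_norm_det_sq e (fun j : Fin n => x ^ (j : ℕ)) (by rwa [hV])
  rw [hV] at h1
  refine h1.trans ?_
  have h2 : ‖(Matrix.vandermonde fun i => e i x).det‖ ^ 2 =
      ∏ i : Fin n, ∏ j ∈ Finset.univ.erase i, ‖e i x - e j x‖ := by
    rw [Matrix.det_vandermonde, norm_prod, ← Finset.prod_pow]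
    simp_rw [norm_prod, ← Finset.prod_pow]
    have := Finset.prod_prod_Ioi_mul_eq_prod_prod_off_diag fun i j : Fin n => ‖e i x - e j x‖
    simp_rw [← Finset.compl_singleton]
    rw [show (∏ i : Fin n, ∏ j ∈ {i}ᶜ, ‖e i x - e j x‖) =
      ∏ i : Fin n, ∏ j ∈ {i}ᶜ, ‖e j x - e i x‖ by simp_rw [norm_sub_rev], ← this]
    simp_rw [sq]
    refine Finset.prod_congr rfl fun i _ => Finset.prod_congr rfl fun j _ => ?_
    rw [norm_sub_rev (e i x : ℂ)]
  have hP : 0 < ∏ σ, T σ := Finset.prod_pos fun σ _ => hT σ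
  calc _ = ∏ i : Fin n, ∏ j ∈ Finset.univ.erase i, ‖e i x - e j x‖ := h2
    _ ≤ ∏ i : Fin n, ∏ j ∈ Finset.univ.erase i, c * (T (e i) * T (e j)) := by
        refine Finset.prod_le_prod (fun i _ => Finset.prod_nonneg fun j _ => norm_nonneg _)
          fun i _ => Finset.prod_le_prod (fun j _ => norm_nonneg _) fun j hj => h _ _ ?_
        exact e.injective.ne (Finset.ne_of_mem_erase hj).symm
    _ = _ := by
        have h3 : ∏ i : Fin n, T (e i) = ∏ σ, T σ := e.prod_comp T
        have h4 : ∀ i : Fin n, ∏ j ∈ Finset.univ.erase i, c * (T (e i) * T (e j)) =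
            c ^ (n - 1) * T (e i) ^ (n - 1) * ((∏ σ, T σ) * (T (e i))⁻¹) := fun i => by
          have h5 : ∏ j ∈ Finset.univ.erase i, T (e j) = (∏ σ, T σ) * (T (e i))⁻¹ := by
            rw [← h3, ← Finset.mul_prod_erase _ _ (Finset.mem_univ i)]
            have := (hT (e i)).ne'
            field_simp
          rw [Finset.prod_mul_distrib, Finset.prod_mul_distrib, h5]
          simp [mul_assoc]
        simp_rw [h4]
        rw [Finset.prod_mul_distrib, Finset.prod_mul_distrib, Finset.prod_mul_distrib,
          Finset.prod_inv_distrib, h3]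
        simp only [Finset.prod_const, Finset.card_univ, Fintype.card_fin]
        rcases n with _ | n
        · exact absurd hn finrank_pos.ne'
        · simp only [Nat.add_sub_cancel]
          rw [Finset.prod_pow, h3]
          field_simp
          ring

end NumberField

/-! ### Integers of a number field in a box -/

section Boxes

open NumberField

variable {K : Type*} [Field K] [NumberField K] {n : ℕ} {T : (K →+* ℂ) → ℝ} {b d : ℝ}
  {s : Finset (𝓞 K)}

/-- Congruent points of a box differ by a multiple of a point of a small box. -/
theorem norm_le_of_sub_eq_nsmul {p : ℕ} (hp : 0 < p) {x y z : 𝓞 K}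
    (hx : ∀ σ : K →+* ℂ, ‖σ x‖ ≤ T σ) (hy : ∀ σ : K →+* ℂ, ‖σ y‖ ≤ T σ) (h : x - y = p • z)
    (σ : K →+* ℂ) : ‖σ z‖ ≤ 2 / p * T σ := by
  have hp' : (0 : ℝ) < p := by exact_mod_cast hp
  have h1 : σ x - σ y = p * σ z := by
    have := congrArg (fun w : 𝓞 K => σ w) h
    simpa using this
  have h2 : (p : ℝ) * ‖σ z‖ ≤ 2 * T σ := by
    have h3 : ‖σ x - σ y‖ = p * ‖σ z‖ := by rw [h1]; simp
    rw [← h3]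
    exact (norm_sub_le _ _).trans (by linarith [hx σ, hy σ])
  rw [div_mul_eq_mul_div, le_div_iff₀ hp', mul_comm]
  exact h2

theorem prod_const_mul (hn : finrank ℚ K = n) (c : ℝ) (T : (K →+* ℂ) → ℝ) :
    ∏ σ, c * T σ = c ^ n * ∏ σ, T σ := by
  rw [Finset.prod_mul_distrib]
  simp [Embeddings.card, hn]

/-- A box whose sides have product `b ^ n` contains `O(b ^ n)` integers of `K`, uniformly in `K`: by
the norm inequality, a modulus larger than `2 * b` separates them. -/
theorem card_le_of_norm_le (hn : finrank ℚ K = n) (hb : 1 ≤ b) (hbT : b ^ n = ∏ σ, T σ)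
    (hs : ∀ x ∈ s, ∀ σ : K →+* ℂ, ‖σ x‖ ≤ T σ) : (s.card : ℝ) ≤ (3 * b) ^ n := by
  have hn0 : n ≠ 0 := hn ▸ finrank_pos.ne'
  set p : ℕ := ⌊2 * b⌋₊ + 1 with hp
  have hp1 : 2 * b < p := by rw [hp]; push_cast; exact Nat.lt_floor_add_one _
  have hp2 : (p : ℝ) ≤ 3 * b := by
    have := Nat.floor_le (show 0 ≤ 2 * b by linarith)
    rw [hp]; push_cast; linarith
  have hp0 : (0 : ℝ) < p := by linarith
  have key := card_le_mul_pow_finrank (r := n) (k := 1) (by rw [RingOfIntegers.rank, hn])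
    (Nat.succ_pos _ : 0 < p) s id fun x₀ hx₀ u hu hux => by
      refine Finset.card_le_one_iff_subset_singleton.mpr ⟨x₀, fun x hx => ?_⟩
      obtain ⟨z, hz⟩ := hux x hx
      have hz0 : z = 0 := by
        refine eq_zero_of_prod_lt_one (T := fun σ => 2 / p * T σ) ?_
          (norm_le_of_sub_eq_nsmul (Nat.succ_pos _) (hs x (hu hx)) (hs x₀ hx₀) hz)
        rw [prod_const_mul hn, ← hbT, ← mul_pow]
        refine pow_lt_one₀ (by positivity) ?_ hn0
        rw [div_mul_eq_mul_div, div_lt_one hp0]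
        exact hp1
      rw [hz0, smul_zero] at hz
      exact Finset.mem_singleton.mpr (sub_eq_zero.mp hz)
  calc (s.card : ℝ) ≤ ((1 * p ^ n : ℕ) : ℝ) := by exact_mod_cast key
    _ = (p : ℝ) ^ n := by push_cast; ring
    _ ≤ _ := by gcongr

/-- The linear map that sends an integer `x` of `K` to the family of the differences `σ x - τ x` of
its conjugates. Its kernel is `ℤ`, so its range stands for the quotient lattice `𝓞 K / ℤ`. -/
noncomputable def conjDiff (K : Type*) [Field K] [NumberField K] :
    𝓞 K →ₗ[ℤ] ((K →+* ℂ) → (K →+* ℂ) → ℂ) where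
  toFun x σ τ := σ x - τ x
  map_add' x y := by ext σ τ; simp; ring
  map_smul' c x := by ext σ τ; simp; ring

theorem finrank_range_conjDiff_le (hn : finrank ℚ K = n) :
    finrank ℤ (LinearMap.range (conjDiff K)) ≤ n - 1 := by
  have h1 := Submodule.finrank_quotient_add_finrank (LinearMap.ker (conjDiff K))
  rw [(conjDiff K).quotKerEquivRange.finrank_eq] at h1
  rw [RingOfIntegers.rank, hn] at h1
  have : Nontrivial (LinearMap.ker (conjDiff K)) :=
    ⟨⟨1, by ext; simp [conjDiff]⟩, 0, fun h => one_ne_zero (congrArg Subtype.val h)⟩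
  have : 0 < finrank ℤ (LinearMap.ker (conjDiff K)) := finrank_pos
  omega

/-- The number of generators of `K` in a box whose sides have product `b ^ n`, when `K` has no
intermediate fields and the discriminant `d ^ (n * (n - 1))` is large compared with the box, or
`n = 2`. The smallest side `t` of the box matters: a class modulo `ℤ` has `O(t)` points in the box,
while `max (T σ) (T τ) ≤ T σ * T τ / t` in the discriminant inequality, and the two effects cancel. -/
theorem card_le_of_le_discr (hn : finrank ℚ K = n) (hn2 : 2 ≤ n)
    (hK : ∀ x : 𝓞 K, (∃ a : ℤ, x = a) ∨ Function.Injective fun σ : K →+* ℂ => σ x)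
    (hb : 1 ≤ b) (hbT : b ^ n = ∏ σ, T σ) (hT : ∀ σ, 1 ≤ T σ)
    (hd : 1 ≤ d) (hdK : d ^ (n * (n - 1)) = ((|discr K| : ℤ) : ℝ))
    (hs : ∀ x ∈ s, ∀ σ : K →+* ℂ, ‖σ x‖ ≤ T σ)
    (hs' : ∀ x ∈ s, Function.Injective fun σ : K →+* ℂ => σ x) (hbd : n = 2 ∨ b ≤ d) :
    (s.card : ℝ) ≤ 5 * 6 ^ (n - 1) * (b ^ n / d) := by
  classical
  rcases s.eq_empty_or_nonempty with rfl | ⟨x₁, hx₁⟩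
  · simp; positivity
  have hnn : n * (n - 1) ≠ 0 := Nat.mul_ne_zero (by omega) (by omega)
  have hcard : Fintype.card (K →+* ℂ) = n := by rw [Embeddings.card, hn]
  have : Nontrivial (K →+* ℂ) := Fintype.one_lt_card_iff_nontrivial.mp (by omega)
  obtain ⟨σ₀, hσ₀⟩ := Finite.exists_min T
  set t := T σ₀ with ht
  have ht1 : 1 ≤ t := hT σ₀
  have hTT : ∀ σ τ, T σ ≤ T σ * T τ / t ∧ T τ ≤ T σ * T τ / t := fun σ τ => by
    have h1 := hT σ
    have h2 := hT τ
    have h3 := hσ₀ σ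
    have h4 := hσ₀ τ
    constructor
    · rw [le_div_iff₀ (by linarith)]; gcongr
    · rw [le_div_iff₀ (by linarith), mul_comm]; gcongr
  -- The discriminant inequality for elements whose differences of conjugates are small.
  have hdisc : ∀ (z : 𝓞 K) (c : ℝ), 0 ≤ c →
      (∀ σ τ : K →+* ℂ, ‖σ z - τ z‖ ≤ c * (T σ * T τ / t)) →
      (Function.Injective fun σ : K →+* ℂ => σ z) → d ≤ c / t * b ^ 2 := by
    intro z c hc hz hzi
    have h1 := discr_le_of_norm_sub_le hn hzi (fun σ => one_pos.trans_le (hT σ)) (c := c / t)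
      fun σ τ _ => (hz σ τ).trans_eq (by ring)
    rw [← hdK, ← hbT, ← pow_mul b, show n * (2 * (n - 1)) = 2 * (n * (n - 1)) by ring, pow_mul b,
      ← mul_pow] at h1
    exact le_of_pow_le_pow_left₀ hnn (by positivity) h1
  -- `w` is at least `1` because the box contains a generator of `K`; a modulus larger than `2 * w`
  -- separates the points of the box modulo `ℤ`.
  set w := 2 * b ^ 2 / (t * d) with hw
  have hw1 : 1 ≤ w := by
    have := hdisc x₁ 2 zero_le_two (fun σ τ => (norm_sub_le _ _).trans
      (by linarith [hs x₁ hx₁ σ, hs x₁ hx₁ τ, (hTT σ τ).1, (hTT σ τ).2])) (hs' x₁ hx₁)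
    rw [hw, one_le_div (by positivity)]
    rw [div_mul_eq_mul_div, le_div_iff₀ (by positivity)] at this
    linarith
  set p : ℕ := ⌊2 * w⌋₊ + 1 with hp
  have hp1 : 2 * w < p := by rw [hp]; push_cast; exact Nat.lt_floor_add_one _
  have hp2 : (p : ℝ) ≤ 3 * w := by
    have := Nat.floor_le (show 0 ≤ 2 * w by linarith)
    rw [hp]; push_cast; linarith
  have hp0 : (0 : ℝ) < p := by linarith
  set N : ℕ := ⌊2 * t⌋₊ with hN
  have hNt : (N : ℝ) ≤ 2 * t := Nat.floor_le (by linarith)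
  have key := card_le_mul_pow_finrank (finrank_range_conjDiff_le hn) (k := 2 * N + 1)
    (Nat.succ_pos _ : 0 < p) s (fun x => (⟨conjDiff K x, x, rfl⟩ : LinearMap.range (conjDiff K)))
    fun x₀ hx₀ u hu hux => by
      have hmem : ∀ x ∈ u, ∃ a ∈ Finset.Icc (-N : ℤ) N, x₀ + (a : 𝓞 K) = x := fun x hx => by
        obtain ⟨⟨_, z, rfl⟩, hz⟩ := hux x hx
        have hz : conjDiff K x - conjDiff K x₀ = p • conjDiff K z := congrArg Subtype.val hz
        have hz' : ∀ σ τ : K →+* ℂ, (σ x - τ x) - (σ x₀ - τ x₀) = p * (σ z - τ z) := fun σ τ => by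
          have := congrFun (congrFun hz σ) τ
          simpa [conjDiff] using this
        have hz0 : conjDiff K z = 0 := by
          rcases hK z with ⟨a, rfl⟩ | hzi
          · ext σ τ; simp [conjDiff]
          exfalso
          have h1 := hdisc z (4 / p) (by positivity) (fun σ τ => by
            have h2 : p * ‖σ z - τ z‖ = ‖(σ x - τ x) - (σ x₀ - τ x₀)‖ := by rw [hz']; simp
            have h3 : ‖(σ x - τ x) - (σ x₀ - τ x₀)‖ ≤ (T σ + T τ) + (T σ + T τ) :=
              (norm_sub_le _ _).trans (add_le_add
                ((norm_sub_le _ _).trans (add_le_add (hs x (hu hx) σ) (hs x (hu hx) τ)))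
                ((norm_sub_le _ _).trans (add_le_add (hs x₀ hx₀ σ) (hs x₀ hx₀ τ))))
            rw [div_mul_eq_mul_div, le_div_iff₀ hp0, mul_comm, h2]
            linarith [(hTT σ τ).1, (hTT σ τ).2]) hzi
          have h2 : p ≤ 2 * w := by
            rw [div_div, div_mul_eq_mul_div, le_div_iff₀ (by positivity)] at h1
            rw [hw, mul_div_assoc', le_div_iff₀ (by positivity)]
            linarith
          linarith
        have hxx : conjDiff K (x - x₀) = 0 := by rw [map_sub, hz, hz0, smul_zero]
        rcases hK (x - x₀) with ⟨a, ha⟩ | hi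
        · refine ⟨a, ?_, by rw [← ha]; ring⟩
          have h1 : ‖σ₀ x - σ₀ x₀‖ ≤ 2 * t :=
            (norm_sub_le _ _).trans (by linarith [hs x (hu hx) σ₀, hs x₀ hx₀ σ₀])
          have h2 : σ₀ x - σ₀ x₀ = a := by
            have := congrArg (fun w : 𝓞 K => σ₀ w) ha
            simpa using this
          rw [h2, Complex.norm_intCast] at h1
          have h3 : a.natAbs ≤ N := Nat.le_floor (by rwa [Nat.cast_natAbs, Int.cast_abs])
          rw [Finset.mem_Icc]; omega
        · obtain ⟨σ, τ, hne⟩ := exists_pair_ne (K →+* ℂ)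
          refine absurd (hi ?_) hne
          have := congrFun (congrFun hxx σ) τ
          simpa [conjDiff, sub_eq_zero] using this
      have hsub : u ⊆ (Finset.Icc (-N : ℤ) N).image fun a : ℤ => x₀ + (a : 𝓞 K) := fun x hx => by
        obtain ⟨a, ha, rfl⟩ := hmem x hx
        exact Finset.mem_image_of_mem _ ha
      refine (Finset.card_le_card hsub).trans (Finset.card_image_le.trans ?_)
      simp; omega
  have ht0 : 0 < t := by linarith
  calc (s.card : ℝ) ≤ (((2 * N + 1) * p ^ (n - 1) : ℕ) : ℝ) := by exact_mod_cast key
    _ = (2 * N + 1) * (p : ℝ) ^ (n - 1) := by push_cast; ring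
    _ ≤ (5 * t) * (3 * w) ^ (n - 1) := by gcongr; linarith
    _ = 5 * 6 ^ (n - 1) * (t * (b ^ 2 / (t * d)) ^ (n - 1)) := by
      rw [show 3 * w = 6 * (b ^ 2 / (t * d)) by rw [hw]; ring, mul_pow]; ring
    _ ≤ _ := by
      gcongr
      obtain ⟨m, rfl⟩ : ∃ m, n = m + 2 := ⟨n - 2, by omega⟩
      have h1 : b / (t * d) ≤ 1 ∨ m = 0 := by
        rcases hbd with h | h
        · exact Or.inr (by omega)
        · left
          rw [div_le_one (by positivity)]
          nlinarith
      have h2 : (b / (t * d)) ^ m ≤ 1 := by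
        rcases h1 with h1 | rfl
        · exact pow_le_one₀ (by positivity) h1
        · simp
      calc t * (b ^ 2 / (t * d)) ^ (m + 2 - 1) = (b / (t * d)) ^ m * (b ^ (m + 2) / d) := by
            rw [show m + 2 - 1 = m + 1 by omega, pow_succ (b ^ 2 / (t * d)),
              show b ^ 2 / (t * d) = b / (t * d) * b by ring, mul_pow]
            field_simp
            ring
        _ ≤ 1 * (b ^ (m + 2) / d) := by gcongr
        _ = _ := one_mul _

end Boxes

/-! ### Boxes that are large compared with the discriminant -/

section LargeBoxes

open NumberField

variable {K : Type*} [Field K] [NumberField K] {n : ℕ} {T : (K →+* ℂ) → ℝ} {b d : ℝ}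
  {s : Finset (𝓞 K)}

theorem norm_det_le_factorial_mul {n : ℕ} {A : Matrix (Fin n) (Fin n) ℂ} {c : Fin n → ℝ}
    (h : ∀ i j, ‖A i j‖ ≤ c i) : ‖A.det‖ ≤ n.factorial * ∏ i, c i := by
  rw [← Matrix.det_transpose, Matrix.det_apply]
  refine (norm_sum_le _ _).trans ?_
  calc _ ≤ ∑ _σ : Equiv.Perm (Fin n), ∏ i, c i := Finset.sum_le_sum fun σ _ => by
        have : ‖Equiv.Perm.sign σ • ∏ i, A.transpose (σ i) i‖ = ∏ i, ‖A.transpose (σ i) i‖ := by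
          rcases Int.units_eq_one_or (Equiv.Perm.sign σ) with h | h <;> simp [h]
        rw [this]
        exact Finset.prod_le_prod (fun _ _ => norm_nonneg _) fun i _ => h _ _
    _ = _ := by simp [Fintype.card_perm]

/-- A basis of `K` consisting of integers does not fit into a box if the product of its sides is
small compared with the square root of the discriminant. -/
theorem discr_le_of_linearIndependent (hn : finrank ℚ K = n) {v : Fin n → 𝓞 K}
    (hv : LinearIndependent ℚ fun i => (v i : K)) (h : ∀ i, ∀ σ : K →+* ℂ, ‖σ (v i)‖ ≤ T σ) :
    ((|discr K| : ℤ) : ℝ) ≤ (n.factorial * ∏ σ, T σ) ^ 2 := by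
  classical
  have hcard : Fintype.card (K →+* ℂ) = n := by rw [Embeddings.card, hn]
  let e : Fin n ≃ (K →+* ℂ) := (Fintype.equivFinOfCardEq hcard).symm
  have h0 : (Matrix.of fun i j => e i (v j)).det ≠ 0 := by
    have : Nonempty (Fin n) := ⟨⟨0, hn ▸ finrank_pos⟩⟩
    let B := basisOfLinearIndependentOfCardEqFinrank hv (by simp [hn])
    have h1 := Algebra.discr_not_zero_of_basis ℚ B
    have h2 := Algebra.discr_eq_det_embeddingsMatrixReindex_pow_two ℚ ℂ B
      (e.trans (RingHom.equivRatAlgHom K ℂ))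
    intro h3
    refine h1 ((algebraMap ℚ ℂ).injective ?_)
    rw [h2, map_zero, sq_eq_zero_iff, ← h3, ← Matrix.det_transpose]
    congr 1
    ext i j
    simp [Algebra.embeddingsMatrixReindex, B]
  refine (discr_le_norm_det_sq e v h0).trans ?_
  gcongr
  refine (norm_det_le_factorial_mul (c := fun i => T (e i)) fun i j => h j (e i)).trans_eq ?_
  rw [e.prod_comp T]

/-- The rank of the lattice spanned by a set of integers of `K` is the dimension of its span over
`ℚ`, so it is less than `n` if the set contains no `n` independent elements. -/
theorem finrank_span_lt {Z : Set (𝓞 K)}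
    (hZ : ∀ v : Fin n → 𝓞 K, (∀ i, v i ∈ Z) → ¬ LinearIndependent ℚ fun i => (v i : K)) :
    finrank ℤ (Submodule.span ℤ Z) < n := by
  by_contra! hlt
  obtain ⟨v, hv⟩ : ∃ v : Fin n → 𝓞 K, (∀ i, v i ∈ Submodule.span ℤ Z) ∧ LinearIndependent ℤ v := by
    let B := Module.finBasis ℤ (Submodule.span ℤ Z)
    refine ⟨fun i => B (Fin.castLE hlt i), fun i => (B _).2, ?_⟩
    exact (B.linearIndependent.comp _ (Fin.castLE_injective hlt)).map' (Submodule.subtype _)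
      (Submodule.ker_subtype _)
  set V := Submodule.span ℚ ((fun z : 𝓞 K => (z : K)) '' Z) with hV
  have hvV : ∀ i, (v i : K) ∈ V := fun i => by
    have : Submodule.span ℤ Z ≤ (V.restrictScalars ℤ).comap
        (Algebra.linearMap (𝓞 K) K |>.restrictScalars ℤ) :=
      Submodule.span_le.mpr fun z hz => Submodule.subset_span ⟨z, hz, rfl⟩
    exact this (hv.1 i)
  have hvQ : LinearIndependent ℚ fun i => (v i : K) := by
    rw [← LinearIndependent.iff_fractionRing (R := ℤ)]
    exact hv.2.map' (Algebra.linearMap (𝓞 K) K |>.restrictScalars ℤ)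
      (LinearMap.ker_eq_bot.mpr RingOfIntegers.coe_injective)
  have hle : n ≤ finrank ℚ V := by
    have h1 : LinearIndependent ℚ fun i => (⟨v i, hvV i⟩ : V) :=
      LinearIndependent.of_comp V.subtype hvQ
    simpa using h1.fintype_card_le_finrank
  obtain ⟨f, hf, -, hfi⟩ := Submodule.exists_fun_fin_finrank_span_eq ℚ
    ((fun z : 𝓞 K => (z : K)) '' Z)
  choose g hg hgf using hf
  refine hZ (fun i => g (Fin.castLE hle i)) (fun i => hg _) ?_
  simp only [hgf]
  exact hfi.comp _ (Fin.castLE_injective hle)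

/-- The number of integers of `K` in a box whose sides have product `b ^ n` when the discriminant
`d ^ (n * (n - 1))` is at most `b ^ (n * (n - 1))`. The hypothesis `3 ≤ n` gives
`d ^ n ≤ √(d ^ (n * (n - 1)))`, which makes the box of the integers in `Z` below too small for a
basis of `K`. -/
theorem card_le_of_discr_le (hn : finrank ℚ K = n) (hn3 : 3 ≤ n)
    (hb : 1 ≤ b) (hbT : b ^ n = ∏ σ, T σ)
    (hd : 1 ≤ d) (hdK : d ^ (n * (n - 1)) = ((|discr K| : ℤ) : ℝ))
    (hs : ∀ x ∈ s, ∀ σ : K →+* ℂ, ‖σ x‖ ≤ T σ) (hbd : d ≤ b) :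
    (s.card : ℝ) ≤ (16 * n.factorial) ^ n * (b ^ n / d) := by
  have hn0 : n ≠ 0 := by omega
  have hF : (1 : ℝ) ≤ n.factorial := by exact_mod_cast n.factorial_pos
  set F : ℝ := ((n.factorial : ℕ) : ℝ)
  set ν : ℝ := d / (2 * F * b) with hν
  have hν0 : 0 < ν := by positivity
  set Z : Set (𝓞 K) := {z | ∀ σ : K →+* ℂ, ‖σ z‖ ≤ ν * T σ} with hZ
  -- `ν` is so small that `Z` contains no basis of `K`, by the determinant inequality.
  have hM : finrank ℤ (Submodule.span ℤ Z) ≤ n - 1 := by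
    refine Nat.le_sub_one_of_lt (finrank_span_lt fun v hv hvi => ?_)
    have h1 := discr_le_of_linearIndependent hn hvi hv
    rw [prod_const_mul hn, ← hbT, ← hdK] at h1
    have h2 : F * (ν ^ n * b ^ n) ≤ d ^ n / 2 ^ n := by
      have : ν * b = d / (2 * F) := by rw [hν]; field_simp
      rw [← mul_pow, this, div_pow, mul_pow, mul_div_assoc', div_le_div_iff₀ (by positivity)
        (by positivity)]
      have : F ≤ F ^ n := le_self_pow₀ hF hn0
      nlinarith [show 0 ≤ d ^ n * 2 ^ n by positivity]
    have h3 : (d ^ n / 2 ^ n) ^ 2 < d ^ (n * (n - 1)) := by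
      calc (d ^ n / 2 ^ n) ^ 2 < (d ^ n) ^ 2 := by
            gcongr
            exact div_lt_self (by positivity) (one_lt_pow₀ one_lt_two hn0)
        _ = d ^ (n * 2) := by rw [pow_mul]
        _ ≤ _ := pow_le_pow_right₀ hd (Nat.mul_le_mul_left _ (by omega))
    have h4 : (F * (ν ^ n * b ^ n)) ^ 2 ≤ (d ^ n / 2 ^ n) ^ 2 := by gcongr
    linarith
  -- Points of the box that are congruent modulo `p` differ by `p` times an element of `Z`. When
  -- these elements are congruent modulo `q` in the span of `Z`, the points are congruent modulo
  -- `p * q` and equal, by the norm inequality.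
  set p : ℕ := ⌊2 / ν⌋₊ + 1 with hp
  have hνb : 2 / ν = 4 * F * (b / d) := by rw [hν]; field_simp; ring
  have hbd1 : 1 ≤ b / d := (one_le_div (by linarith)).mpr hbd
  have hp1 : 2 / ν < p := by rw [hp]; push_cast; exact Nat.lt_floor_add_one _
  have hp2 : (p : ℝ) ≤ 8 * F * (b / d) := by
    have := Nat.floor_le (show 0 ≤ 2 / ν by positivity)
    have h1 : 1 ≤ F * (b / d) := one_le_mul_of_one_le_of_one_le hF hbd1
    rw [hp]; push_cast; linarith
  have hp0 : (0 : ℝ) < p := hp1.trans' (by positivity)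
  set q : ℕ := ⌊2 * b / p⌋₊ + 1 with hq
  have hq1 : 2 * b / p < q := by rw [hq]; push_cast; exact Nat.lt_floor_add_one _
  have hq2 : (q : ℝ) ≤ 2 * d := by
    have h1 := Nat.floor_le (show 0 ≤ 2 * b / p by positivity)
    have h2 : 2 * b / p ≤ d := by
      rw [div_le_iff₀ hp0]
      rw [hνb] at hp1
      have : d * (4 * F * (b / d)) ≤ d * p := by gcongr
      rw [show d * (4 * F * (b / d)) = 4 * F * b by field_simp] at this
      nlinarith
    rw [hq]; push_cast; linarith
  have hq0 : (0 : ℝ) < q := hq1.trans' (by positivity)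
  have hpos : 0 < p := Nat.succ_pos _
  have hqos : 0 < q := Nat.succ_pos _
  have key := card_le_mul_pow_finrank (r := n) (k := q ^ (n - 1)) (by rw [RingOfIntegers.rank, hn])
    hpos s id fun x₀ hx₀ u hu hux => by
      choose! z hz using hux
      have hzZ : ∀ x ∈ u, z x ∈ Z := fun x hx σ =>
        (norm_le_of_sub_eq_nsmul hpos (hs x (hu hx)) (hs x₀ hx₀) (hz x hx) σ).trans <| by
          have := (norm_nonneg _).trans (hs x₀ hx₀ σ)
          gcongr
          rw [div_le_iff₀ hp0]
          rw [div_lt_iff₀ hν0] at hp1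
          linarith
      have key2 := card_le_mul_pow_finrank hM (k := 1) hqos u.attach
        (fun x => (⟨z x, Submodule.subset_span (hzZ x x.2)⟩ : Submodule.span ℤ Z))
        fun x hx v hv hvx => by
          refine (Finset.card_le_card (t := {x}) fun y hy => ?_).trans (Finset.card_singleton x).le
          obtain ⟨m, hm⟩ := hvx y hy
          have hm : z y - z x = q • (m : 𝓞 K) := congrArg Subtype.val hm
          have hyx : (y : 𝓞 K) - x = (p * q) • (m : 𝓞 K) := by
            have h1 := hz x x.2
            have h2 := hz y y.2
            simp only [id] at h1 h2
            rw [← sub_sub_sub_cancel_right _ _ x₀, h1, h2, ← smul_sub, hm, smul_smul]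
          have hm0 : (m : 𝓞 K) = 0 := by
            refine eq_zero_of_prod_lt_one (T := fun σ => 2 / (p * q : ℕ) * T σ) ?_
              (norm_le_of_sub_eq_nsmul (Nat.mul_pos hpos hqos) (hs y (hu y.2)) (hs x (hu x.2)) hyx)
            rw [prod_const_mul hn, ← hbT, ← mul_pow]
            refine pow_lt_one₀ (by positivity) ?_ hn0
            push_cast
            rw [div_mul_eq_mul_div, div_lt_one (by positivity)]
            rw [div_lt_iff₀ hp0] at hq1
            linarith
          rw [hm0, smul_zero] at hyx
          exact Finset.mem_singleton.mpr (Subtype.ext (sub_eq_zero.mp hyx))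
      simpa using key2
  calc (s.card : ℝ) ≤ ((q ^ (n - 1) * p ^ n : ℕ) : ℝ) := by exact_mod_cast key
    _ = (q : ℝ) ^ (n - 1) * (p : ℝ) ^ n := by push_cast; ring
    _ ≤ (2 * d) ^ (n - 1) * (8 * F * (b / d)) ^ n := by gcongr
    _ = 2 ^ (n - 1) * (8 * F) ^ n * (b ^ n / d) := by
      obtain ⟨m, rfl⟩ : ∃ m, n = m + 1 := ⟨n - 1, by omega⟩
      simp only [Nat.add_sub_cancel, mul_pow, div_pow, pow_succ]
      field_simp
    _ ≤ 2 ^ n * (8 * F) ^ n * (b ^ n / d) := by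
      gcongr
      · norm_num
      · omega
    _ = _ := by rw [← mul_pow]; ring

/-- The number of generators of `K` in a box, when `K` has no intermediate fields. -/
theorem card_le_of_primitive (hn : finrank ℚ K = n) (hn2 : 2 ≤ n)
    (hK : ∀ x : 𝓞 K, (∃ a : ℤ, x = a) ∨ Function.Injective fun σ : K →+* ℂ => σ x)
    (hT : ∀ σ, 1 ≤ T σ) (hs : ∀ x ∈ s, ∀ σ : K →+* ℂ, ‖σ x‖ ≤ T σ)
    (hs' : ∀ x ∈ s, Function.Injective fun σ : K →+* ℂ => σ x) :
    (s.card : ℝ) ≤ (16 * n.factorial) ^ n *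
      ((∏ σ, T σ) * ((|discr K| : ℤ) : ℝ) ^ (-(1 / ((n : ℝ) ^ 2 - n)))) := by
  have hn0 : n ≠ 0 := by omega
  have hP1 : 1 ≤ ∏ σ, T σ := Finset.one_le_prod fun σ _ => hT σ
  have hD1 : (1 : ℝ) ≤ ((|discr K| : ℤ) : ℝ) := by
    exact_mod_cast Int.one_le_abs (discr_ne_zero K)
  set P := ∏ σ, T σ with hP
  set D := ((|discr K| : ℤ) : ℝ)
  have hb1 : 1 ≤ P ^ (1 / (n : ℝ)) := Real.one_le_rpow hP1 (by positivity)
  have hbT : (P ^ (1 / (n : ℝ))) ^ n = ∏ σ, T σ := by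
    rw [one_div]; exact Real.rpow_inv_natCast_pow (by linarith) hn0
  have hnn : (n : ℝ) ^ 2 - n = ((n * (n - 1) : ℕ) : ℝ) := by
    rw [Nat.cast_mul, Nat.cast_sub (by omega)]; push_cast; ring
  rw [Real.rpow_neg (by linarith), ← div_eq_mul_inv, hnn, hP, ← hbT]
  have hd1 : 1 ≤ D ^ (1 / ((n * (n - 1) : ℕ) : ℝ)) := Real.one_le_rpow hD1 (by positivity)
  have hdK : (D ^ (1 / ((n * (n - 1) : ℕ) : ℝ))) ^ (n * (n - 1)) = D := by
    rw [one_div]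
    exact Real.rpow_inv_natCast_pow (by linarith) (Nat.mul_ne_zero hn0 (by omega))
  by_cases hbd : n = 2 ∨ P ^ (1 / (n : ℝ)) ≤ D ^ (1 / ((n * (n - 1) : ℕ) : ℝ))
  · refine (card_le_of_le_discr hn hn2 hK hb1 hbT hT hd1 hdK hs hs' hbd).trans ?_
    gcongr
    have hF : (1 : ℝ) ≤ n.factorial := by exact_mod_cast n.factorial_pos
    calc (5 : ℝ) * 6 ^ (n - 1) ≤ 16 * 16 ^ (n - 1) := by gcongr <;> norm_num
      _ = 16 ^ n := by rw [← pow_succ']; congr 1; omega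
      _ ≤ _ := by gcongr; linarith
  · push Not at hbd
    exact card_le_of_discr_le hn (by omega) hb1 hbT hd1 hdK hs hbd.2.le

end LargeBoxes

/-! ### Integers of bounded Mahler measure -/

section Mahler

open NumberField

variable {K : Type*} [Field K] [NumberField K] {n : ℕ} {s : Finset (𝓞 K)}

/-- Round the size of each conjugate of `x` up to a power of two, then enlarge one of the exponents
to make their sum independent of `x`. -/
theorem exists_sum_eq_and_le_two_pow (hn : finrank ℚ K = n) {m : ℕ} {x : 𝓞 K}
    (hx : ∏ σ : K →+* ℂ, max 1 ‖σ x‖ ≤ 2 ^ m) :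
    ∃ k : (K →+* ℂ) → ℕ, ∑ σ, k σ = m + n ∧ ∀ σ : K →+* ℂ, ‖σ x‖ ≤ 2 ^ k σ := by
  classical
  choose k hk1 hk2 using fun σ : K →+* ℂ =>
    exists_nat_pow_near (le_max_left 1 ‖σ x‖) (one_lt_two (α := ℝ))
  have hsum : ∑ σ, k σ ≤ m := by
    have h1 : (2 : ℝ) ^ (∑ σ, k σ) ≤ 2 ^ m := by
      rw [← Finset.prod_pow_eq_pow_sum]
      exact (Finset.prod_le_prod (fun _ _ => by positivity) fun σ _ => hk1 σ).trans hx
    exact (pow_le_pow_iff_right₀ one_lt_two).mp h1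
  obtain ⟨σ₀⟩ : Nonempty (K →+* ℂ) := inferInstance
  refine ⟨fun σ => k σ + 1 + if σ = σ₀ then m - ∑ σ, k σ else 0, ?_, fun σ => ?_⟩
  · have : Fintype.card (K →+* ℂ) = n := by rw [Embeddings.card, hn]
    simp [Finset.sum_add_distrib, this]
    omega
  · exact (le_max_right _ _).trans ((hk2 σ).le.trans (pow_le_pow_right₀ one_le_two
      (Nat.le_add_right (k σ + 1) _)))

/-- The region of Mahler measure at most `2 ^ m` is covered by `(m + n + 1) ^ (n - 1)` boxes whose
sides have product `2 ^ (m + n)`. -/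
theorem card_le_of_forall_box (hn : finrank ℚ K = n) {m : ℕ} {A : ℝ}
    (hs : ∀ x ∈ s, ∏ σ : K →+* ℂ, max 1 ‖σ x‖ ≤ 2 ^ m)
    (hA : ∀ T : (K →+* ℂ) → ℝ, (∀ σ, 1 ≤ T σ) → ∏ σ, T σ = 2 ^ (m + n) → ∀ u ⊆ s,
      (∀ x ∈ u, ∀ σ : K →+* ℂ, ‖σ x‖ ≤ T σ) → (u.card : ℝ) ≤ A) :
    (s.card : ℝ) ≤ A * (m + n + 1) ^ (n - 1) := by
  classical
  have hA0 : 0 ≤ A := by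
    obtain ⟨k, hk, -⟩ := exists_sum_eq_and_le_two_pow (K := K) hn (m := m) (x := 0)
      (by simp [one_le_pow₀])
    simpa using hA (fun σ => 2 ^ k σ) (fun σ => one_le_pow₀ one_le_two)
      (by rw [Finset.prod_pow_eq_pow_sum, hk]) ∅ (by simp) (by simp)
  choose! k hk1 hk2 using fun x hx => exists_sum_eq_and_le_two_pow hn (hs x hx)
  have hA' : ∀ x₀ ∈ s, ∀ u ⊆ s, (∀ x ∈ u, k x = k x₀) → (u.card : ℝ) ≤ A :=
    fun x₀ hx₀ u hu h => hA (fun σ => 2 ^ k x₀ σ) (fun σ => one_le_pow₀ one_le_two)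
      (by rw [Finset.prod_pow_eq_pow_sum, hk1 x₀ hx₀]) u hu
      fun x hx σ => by rw [← h x hx]; exact hk2 x (hu hx) σ
  obtain ⟨σ₀⟩ : Nonempty (K →+* ℂ) := inferInstance
  -- The exponents have a given sum, so the one at `σ₀` is determined by the others.
  let g : 𝓞 K → {σ : K →+* ℂ // σ ≠ σ₀} → ℕ := fun x σ => k x σ
  have hg : ∀ x ∈ s, ∀ y ∈ s, g x = g y → k x = k y := fun x hx y hy h => by
    have h1 : ∀ σ ≠ σ₀, k x σ = k y σ := fun σ hσ => congrFun h ⟨σ, hσ⟩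
    have h2 := (hk1 x hx).trans (hk1 y hy).symm
    have h3 : ∑ σ ∈ Finset.univ.erase σ₀, k x σ = ∑ σ ∈ Finset.univ.erase σ₀, k y σ :=
      Finset.sum_congr rfl fun σ hσ => h1 σ (Finset.ne_of_mem_erase hσ)
    have h4 := Finset.add_sum_erase _ (k x) (Finset.mem_univ σ₀)
    have h5 := Finset.add_sum_erase _ (k y) (Finset.mem_univ σ₀)
    ext σ
    by_cases hσ : σ = σ₀
    · subst hσ; linarith
    · exact h1 σ hσ
  have key := Finset.card_le_mul_card_image (f := g) s ⌊A⌋₊ fun a ha => by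
    obtain ⟨x₀, hx₀, rfl⟩ := Finset.mem_image.mp ha
    refine Nat.le_floor (hA' x₀ hx₀ _ (Finset.filter_subset _ _) fun x hx => ?_)
    exact hg x (Finset.mem_filter.mp hx).1 x₀ hx₀ (Finset.mem_filter.mp hx).2
  have himg : (s.image g).card ≤ (m + n + 1) ^ (n - 1) := by
    have hsub : s.image g ⊆ Fintype.piFinset fun _ => Finset.range (m + n + 1) := fun a ha => by
      obtain ⟨x, hx, rfl⟩ := Finset.mem_image.mp ha
      refine Fintype.mem_piFinset.mpr fun σ => Finset.mem_range.mpr (Nat.lt_succ_of_le ?_)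
      rw [← hk1 x hx]
      exact Finset.single_le_sum (f := k x) (fun _ _ => Nat.zero_le _) (Finset.mem_univ σ.1)
    refine (Finset.card_le_card hsub).trans_eq ?_
    have : Fintype.card {σ : K →+* ℂ // σ ≠ σ₀} = n - 1 := by
      rw [Fintype.card_subtype_compl, Embeddings.card, hn]; simp
    simp [this]
  calc (s.card : ℝ) ≤ ((⌊A⌋₊ * (s.image g).card : ℕ) : ℝ) := by exact_mod_cast key
    _ ≤ A * (((m + n + 1) ^ (n - 1) : ℕ) : ℝ) := by
      push_cast only [Nat.cast_mul]
      exact mul_le_mul (Nat.floor_le hA0) (by exact_mod_cast himg) (by positivity) hA0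
    _ = _ := by push_cast; ring

theorem card_le_of_mahler_le (hn : finrank ℚ K = n) {m : ℕ}
    (hs : ∀ x ∈ s, ∏ σ : K →+* ℂ, max 1 ‖σ x‖ ≤ 2 ^ m) :
    (s.card : ℝ) ≤ (16 * n.factorial) ^ n * 2 ^ (m + n) * (m + n + 1) ^ (n - 1) := by
  refine card_le_of_forall_box hn hs fun T hT hTP u _ hu => ?_
  have hn0 : n ≠ 0 := hn ▸ finrank_pos.ne'
  have hb : (((2 : ℝ) ^ (m + n)) ^ (1 / (n : ℝ))) ^ n = ∏ σ, T σ := by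
    rw [hTP, one_div]
    exact Real.rpow_inv_natCast_pow (by positivity) hn0
  refine (card_le_of_norm_le hn (Real.one_le_rpow (one_le_pow₀ one_le_two) (by positivity)) hb
    hu).trans ?_
  rw [mul_pow, hb, hTP]
  have hF : (1 : ℝ) ≤ n.factorial := by exact_mod_cast n.factorial_pos
  gcongr
  linarith

theorem card_le_of_primitive_of_mahler_le (hn : finrank ℚ K = n) (hn2 : 2 ≤ n)
    (hK : ∀ x : 𝓞 K, (∃ a : ℤ, x = a) ∨ Function.Injective fun σ : K →+* ℂ => σ x) {m : ℕ}
    (hs : ∀ x ∈ s, ∏ σ : K →+* ℂ, max 1 ‖σ x‖ ≤ 2 ^ m)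
    (hs' : ∀ x ∈ s, Function.Injective fun σ : K →+* ℂ => σ x) :
    (s.card : ℝ) ≤ (16 * n.factorial) ^ n * 2 ^ (m + n) * (m + n + 1) ^ (n - 1) *
      ((|discr K| : ℤ) : ℝ) ^ (-(1 / ((n : ℝ) ^ 2 - n))) := by
  rw [mul_right_comm]
  refine card_le_of_forall_box hn hs fun T hT hTP u hus hu => ?_
  rw [mul_assoc, ← hTP]
  exact card_le_of_primitive hn hn2 hK hT hu fun x hx => hs' x (hus hx)

end Mahler

/-! ### Integral generators of a number field -/

section Generator

open NumberField

variable {K : Type*} [Field K] [NumberField K] {n : ℕ} {x : 𝓞 K} {f : ℤ[X]}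

theorem image_embeddings_eq_toFinset_roots [DecidableEq ℂ]
    (hx : minpoly ℚ (x : K) = f.map (Int.castRingHom ℚ)) :
    Finset.univ.image (fun σ : K →+* ℂ => σ x) = (f.map (Int.castRingHom ℂ)).roots.toFinset := by
  ext z
  have := Set.ext_iff.mp (Embeddings.range_eval_eq_rootSet_minpoly K ℂ (x : K)) z
  have hf : (f.map (Int.castRingHom ℚ)).map (algebraMap ℚ ℂ) = f.map (Int.castRingHom ℂ) := by
    rw [Polynomial.map_map]; congr 1
  rw [hx, Polynomial.rootSet, Polynomial.aroots, hf] at this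
  simpa using this

theorem nodup_roots_of_minpoly_eq (hx : minpoly ℚ (x : K) = f.map (Int.castRingHom ℚ)) :
    (f.map (Int.castRingHom ℂ)).roots.Nodup := by
  have hf : (f.map (Int.castRingHom ℚ)).map (algebraMap ℚ ℂ) = f.map (Int.castRingHom ℂ) := by
    rw [Polynomial.map_map]; congr 1
  rw [← hf, ← hx]
  exact nodup_roots ((minpoly.irreducible (Algebra.IsIntegral.isIntegral (x : K))).separable.map)

theorem injective_embeddings_of_minpoly_eq (hn : finrank ℚ K = n) (hfm : f.Monic)
    (hfn : f.natDegree = n) (hx : minpoly ℚ (x : K) = f.map (Int.castRingHom ℚ)) :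
    Function.Injective fun σ : K →+* ℂ => σ x := by
  classical
  rw [← Set.injOn_univ, ← Finset.coe_univ, ← Finset.card_image_iff,
    image_embeddings_eq_toFinset_roots hx,
    Multiset.toFinset_card_of_nodup (nodup_roots_of_minpoly_eq hx), Finset.card_univ,
    Embeddings.card, hn, ← hfn, ← (IsAlgClosed.splits _).natDegree_eq_card_roots,
    hfm.natDegree_map]

theorem prod_max_one_eq_mahlerMeasure (hn : finrank ℚ K = n) (hfm : f.Monic)
    (hfn : f.natDegree = n) (hx : minpoly ℚ (x : K) = f.map (Int.castRingHom ℚ)) :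
    ∏ σ : K →+* ℂ, max 1 ‖σ x‖ = (f.map (Int.castRingHom ℂ)).mahlerMeasure := by
  classical
  rw [mahlerMeasure_eq_leadingCoeff_mul_prod_roots, (hfm.map _).leadingCoeff, norm_one, one_mul,
    ← (nodup_roots_of_minpoly_eq hx).dedup, ← Multiset.toFinset_val, ← Finset.prod_eq_multiset_prod,
    ← image_embeddings_eq_toFinset_roots hx,
    Finset.prod_image (injective_embeddings_of_minpoly_eq hn hfm hfn hx).injOn]

theorem prod_max_one_le_supNorm (hn : finrank ℚ K = n) (hfm : f.Monic)
    (hfn : f.natDegree = n) (hx : minpoly ℚ (x : K) = f.map (Int.castRingHom ℚ)) :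
    ∏ σ : K →+* ℂ, max 1 ‖σ x‖ ≤ √(n + 1) * f.supNorm := by
  rw [prod_max_one_eq_mahlerMeasure hn hfm hfn hx]
  have h1 := mahlerMeasure_le_sqrt_natDegree_add_one_mul_supNorm (f.map (Int.castRingHom ℂ))
  rw [hfm.natDegree_map, hfn] at h1
  refine h1.trans_eq ?_
  simp only [supNorm_eq_iSup, coeff_map, eq_intCast, Complex.norm_intCast, Int.norm_eq_abs]

theorem discr_le_of_prod_max_one_le (hn : finrank ℚ K = n)
    (hx : Function.Injective fun σ : K →+* ℂ => σ x) {Y : ℝ}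
    (hY : ∏ σ : K →+* ℂ, max 1 ‖σ x‖ ≤ Y) :
    ((|discr K| : ℤ) : ℝ) ≤ 2 ^ (n * (n - 1)) * Y ^ (2 * (n - 1)) := by
  refine (discr_le_of_norm_sub_le hn hx (T := fun σ => max 1 ‖σ x‖)
    (fun σ => one_pos.trans_le (le_max_left _ _)) (c := 2) fun σ τ _ => ?_).trans ?_
  · have h1 := le_max_left 1 ‖σ x‖
    have h2 := le_max_left 1 ‖τ x‖
    have h3 := le_max_right 1 ‖σ x‖
    have h4 := le_max_right 1 ‖τ x‖
    have := norm_sub_le (σ x) (τ x)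
    nlinarith
  · have : 0 ≤ ∏ σ : K →+* ℂ, max 1 ‖σ x‖ := Finset.prod_nonneg fun σ _ => by positivity
    gcongr

/-- An integer of `K` all of whose conjugates coincide is rational, being its trace divided by the
degree. -/
theorem exists_int_eq_of_embeddings_eq (h : ∀ σ τ : K →+* ℂ, σ x = τ x) :
    ∃ a : ℤ, x = a := by
  obtain ⟨σ₀⟩ : Nonempty (K →+* ℂ) := inferInstance
  have h1 : algebraMap ℚ ℂ (Algebra.trace ℚ K (x : K)) = finrank ℚ K * σ₀ x := by
    rw [trace_eq_sum_embeddings ℂ, ← (RingHom.equivRatAlgHom K ℂ).sum_comp]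
    rw [Finset.sum_congr rfl fun σ _ =>
      show RingHom.equivRatAlgHom K ℂ σ (x : K) = σ₀ x from h σ σ₀]
    simp [Embeddings.card]
  have hn : (finrank ℚ K : ℂ) ≠ 0 := by exact_mod_cast (finrank_pos (R := ℚ) (M := K)).ne'
  have h2 : (x : K) = algebraMap ℚ K (Algebra.trace ℚ K (x : K) / finrank ℚ K) := by
    apply σ₀.injective
    have : σ₀ (algebraMap ℚ K (Algebra.trace ℚ K (x : K) / finrank ℚ K)) =
      algebraMap ℚ ℂ (Algebra.trace ℚ K (x : K) / finrank ℚ K) := by simp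
    rw [this, map_div₀, h1]
    simp; field_simp
  have h3 : IsIntegral ℤ (Algebra.trace ℚ K (x : K) / finrank ℚ K) := by
    rw [← isIntegral_algebraMap_iff (algebraMap ℚ K).injective, ← h2]
    exact x.isIntegral_coe
  obtain ⟨a, ha⟩ := IsIntegrallyClosed.isIntegral_iff.mp h3
  refine ⟨a, RingOfIntegers.coe_injective ?_⟩
  refine h2.trans ?_
  rw [← ha]; simp

end Generator

/-! ### Galois groups of polynomials and of their root fields -/

section Galois

open NumberField

theorem IsPermIsomorphic.of_equiv {n : ℕ} {H Ω H' Ω' : Type*} [Group H] [Group H']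
    {act : H →* Equiv.Perm Ω} {act' : H' →* Equiv.Perm Ω'} {G : Subgroup (Equiv.Perm (Fin n))}
    (hG : IsPermIsomorphic act G) (a : Ω' ≃ Ω) (b : H' ≃* H)
    (h : ∀ σ ω, a (act' σ ω) = act (b σ) (a ω)) : IsPermIsomorphic act' G := by
  obtain ⟨φ, ψ, hφ⟩ := hG
  exact ⟨a.trans φ, b.trans ψ, fun σ ω => by simp [h, hφ]⟩

/-- A complex embedding of `K`, as an embedding into the normal closure of `K` in `ℂ`. -/
noncomputable def toNormalClosure (K : IntermediateField ℚ ℂ) (σ : K →ₐ[ℚ] ℂ) :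
    K →ₐ[ℚ] IntermediateField.normalClosure ℚ K ℂ :=
  σ.codRestrict (IntermediateField.normalClosure ℚ K ℂ).toSubalgebra fun x =>
    σ.fieldRange_le_normalClosure ⟨x, rfl⟩

/-- If the Galois group is primitive, then an integer of `K` is rational or its conjugates are
distinct: the embeddings that agree at `x` form blocks. -/
theorem FieldHasGaloisGroup.exists_int_or_injective {n : ℕ} {G : Subgroup (Equiv.Perm (Fin n))}
    (hG : MulAction.IsPreprimitive G (Fin n)) {K : IntermediateField ℚ ℂ} [NumberField K]
    (hK : FieldHasGaloisGroup K G) (x : 𝓞 K) :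
    (∃ a : ℤ, x = a) ∨ Function.Injective fun σ : K →+* ℂ => σ x := by
  obtain ⟨φ, ψ, hφ⟩ := hK
  rw [or_iff_not_imp_right]
  intro hinj
  simp only [Function.Injective, not_forall] at hinj
  obtain ⟨σ, τ, hστ, hne⟩ := hinj
  have hval : ∀ g i, φ.symm ((ψ g : Equiv.Perm (Fin n)) i) (x : K) = g (φ.symm i (x : K)) := by
    intro g i
    have := hφ g (φ.symm i)
    rw [φ.apply_symm_apply] at this
    rw [← this, φ.symm_apply_apply]
    rfl
  have hval' : ∀ (g : G) i, φ.symm (g • i) (x : K) = ψ.symm g (φ.symm i (x : K)) := by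
    intro g i
    rw [← hval, ψ.apply_symm_apply]
    rfl
  let i := φ (toNormalClosure K σ.toRatAlgHom)
  let j := φ (toNormalClosure K τ.toRatAlgHom)
  have hij : i ≠ j := fun h => hne <| by
    have h1 := φ.injective h
    ext y
    exact congrArg Subtype.val (DFunLike.congr_fun h1 y)
  -- The indices of the embeddings that agree with the `i`-th one at `x` form a block.
  let B : Set (Fin n) := {k | φ.symm k (x : K) = φ.symm i (x : K)}
  have hB : MulAction.IsBlock G B := by
    refine MulAction.isBlock_iff_smul_eq_of_mem.mpr fun g k hk hgk => ?_
    have hgi : ψ.symm g (φ.symm i (x : K)) = φ.symm i (x : K) := by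
      have hk : φ.symm k (x : K) = φ.symm i (x : K) := hk
      have hgk : φ.symm (g • k) (x : K) = φ.symm i (x : K) := hgk
      rwa [hval', hk] at hgk
    ext l
    have hl : φ.symm l (x : K) = ψ.symm g (φ.symm (g⁻¹ • l) (x : K)) := by
      rw [← hval', smul_inv_smul]
    rw [Set.mem_smul_set_iff_inv_smul_mem]
    change φ.symm (g⁻¹ • l) (x : K) = φ.symm i (x : K) ↔ φ.symm l (x : K) = φ.symm i (x : K)
    rw [hl, ← (ψ.symm g).injective.eq_iff, hgi]
  have hBu : B = Set.univ := by
    refine (hG.isTrivialBlock_of_isBlock hB).resolve_left fun hs => hij (hs rfl ?_)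
    change φ.symm j (x : K) = φ.symm i (x : K)
    simp only [i, j, Equiv.symm_apply_apply]
    exact Subtype.ext hστ.symm
  refine exists_int_eq_of_embeddings_eq fun σ' τ' => ?_
  have key : ∀ ρ : K →+* ℂ, toNormalClosure K ρ.toRatAlgHom (x : K) = φ.symm i (x : K) := by
    intro ρ
    have : φ (toNormalClosure K ρ.toRatAlgHom) ∈ B := hBu ▸ Set.mem_univ _
    simpa [B] using this
  exact congrArg Subtype.val ((key σ').trans (key τ').symm)

section Polynomial

variable {F E : Type*} [Field F] [Field E] [Algebra F E] {p : F[X]}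
  [Fact ((p.map (algebraMap F E)).Splits)]

/-- The action of the Galois group of `p` on the roots in `E` is transported from the splitting
field. -/
theorem coe_galActionHom_apply (g : p.Gal) {s : p.SplittingField} {y : p.rootSet E}
    (hs : algebraMap p.SplittingField E s = y) :
    (Gal.galActionHom p E g y : E) = algebraMap p.SplittingField E (g s) := by
  have h1 : ((Gal.rootsEquivRoots p E).symm y : p.SplittingField) = s := by
    apply (algebraMap p.SplittingField E).injective
    rw [hs]
    exact congrArg Subtype.val ((Gal.rootsEquivRoots p E).apply_symm_apply y)
  rw [← h1]
  rfl

theorem exists_algebraMap_splittingField_eq (y : p.rootSet E) :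
    ∃ s : p.SplittingField, algebraMap p.SplittingField E s = y :=
  ⟨(Gal.rootsEquivRoots p E).symm y,
    congrArg Subtype.val ((Gal.rootsEquivRoots p E).apply_symm_apply y)⟩

open IntermediateField

theorem fieldRange_splittingField_eq_normalClosure {α : E} (hint : IsIntegral F α)
    (hα : minpoly F α = p) :
    (IsScalarTower.toAlgHom F p.SplittingField E).fieldRange = normalClosure F F⟮α⟯ E := by
  have hrange := IsSplittingField.adjoin_rootSet_eq_range (L := p.SplittingField) p
    (IsScalarTower.toAlgHom F p.SplittingField E)
  apply le_antisymm
  · have : Algebra.adjoin F (p.rootSet E) ≤ (normalClosure F F⟮α⟯ E).toSubalgebra := by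
      refine Algebra.adjoin_le fun β hβ => ?_
      let ω : F⟮α⟯ →ₐ[F] E := (algHomAdjoinIntegralEquiv F hint).symm ⟨β, by
        rw [hα]; exact mem_aroots.mpr ⟨hα ▸ minpoly.ne_zero hint, (mem_rootSet.mp hβ).2⟩⟩
      exact ω.fieldRange_le_normalClosure
        ⟨AdjoinSimple.gen F α, algHomAdjoinIntegralEquiv_symm_apply_gen F hint _⟩
    rw [hrange] at this
    exact this
  · refine normalClosure_le_iff.mpr fun ω => ?_
    have hle : (⊤ : Subalgebra F F⟮α⟯) ≤
        (IsScalarTower.toAlgHom F p.SplittingField E).range.comap ω := by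
      rw [← (adjoin.powerBasis hint).adjoin_gen_eq_top, adjoin.powerBasis_gen, ← hrange]
      refine Algebra.adjoin_le (Set.singleton_subset_iff.mpr (Algebra.subset_adjoin ?_))
      change ω (AdjoinSimple.gen F α) ∈ p.rootSet E
      rw [mem_rootSet]
      refine ⟨hα ▸ minpoly.ne_zero hint, ?_⟩
      rw [aeval_algHom_apply, ← hα, aeval_gen_minpoly, map_zero]
    rintro _ ⟨y, rfl⟩
    exact hle (Algebra.mem_top : y ∈ ⊤)

/-- The action of `Gal(L/F)` on the embeddings of `F(α)` into its normal closure `L` is isomorphic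
to the action of the Galois group of the minimal polynomial of `α` on its roots: an embedding
corresponds to the image of `α`. -/
theorem exists_equiv_embeddings_rootSet {α : E} (hint : IsIntegral F α) (hα : minpoly F α = p) :
    ∃ (a : (F⟮α⟯ →ₐ[F] normalClosure F F⟮α⟯ E) ≃ p.rootSet E)
      (b : Gal(normalClosure F F⟮α⟯ E/F) ≃* p.Gal), ∀ σ ω,
      a (AlgHom.comp (AlgEquiv.toAlgHom σ) ω) = Gal.galActionHom p E (b σ) (a ω) := by
  set L := normalClosure F F⟮α⟯ E with hL
  let θ : p.SplittingField ≃ₐ[F] L :=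
    (AlgEquiv.ofInjectiveField (IsScalarTower.toAlgHom F p.SplittingField E)).trans
      (equivOfEq (fieldRange_splittingField_eq_normalClosure hint hα))
  have hθ : ∀ s, (θ s : E) = algebraMap p.SplittingField E s := fun s => rfl
  have hp0 : p ≠ 0 := hα ▸ minpoly.ne_zero hint
  have hroot : ∀ ω : F⟮α⟯ →ₐ[F] L, (ω (AdjoinSimple.gen F α) : E) ∈ p.rootSet E := fun ω => by
    have : aeval (L.val.comp ω (AdjoinSimple.gen F α)) p = 0 := by
      rw [aeval_algHom_apply, ← hα, aeval_gen_minpoly, map_zero]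
    exact mem_rootSet.mpr ⟨hp0, this⟩
  let a : (F⟮α⟯ →ₐ[F] L) ≃ p.rootSet E :=
    Equiv.ofBijective (fun ω => ⟨ω (AdjoinSimple.gen F α), hroot ω⟩) <| by
      constructor
      · intro ω ω' h
        refine (adjoin.powerBasis hint).algHom_ext ?_
        rw [adjoin.powerBasis_gen]
        exact Subtype.ext (congrArg (fun z : p.rootSet E => (z : E)) h)
      · intro β
        obtain ⟨s, hs⟩ := exists_algebraMap_splittingField_eq β
        have hs0 : aeval (θ s) p = 0 := by
          apply L.val.toRingHom.injective
          change L.val (aeval (θ s) p) = L.val 0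
          rw [← aeval_algHom_apply, map_zero]
          change aeval (θ s : E) p = 0
          rw [hθ, hs]
          exact (mem_rootSet.mp β.2).2
        refine ⟨(algHomAdjoinIntegralEquiv F hint).symm ⟨θ s, ?_⟩, Subtype.ext ?_⟩
        · rw [hα]; exact mem_aroots.mpr ⟨hp0, hs0⟩
        · simp only [algHomAdjoinIntegralEquiv_symm_apply_gen, hθ, hs]
  refine ⟨a, θ.symm.autCongr, fun σ ω => Subtype.ext ?_⟩
  rw [coe_galActionHom_apply _ (s := θ.symm (ω (AdjoinSimple.gen F α)))
    (by rw [← hθ, θ.apply_symm_apply]; rfl), ← hθ]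
  change (σ (ω (AdjoinSimple.gen F α)) : E) =
    θ (θ.symm (σ (θ (θ.symm (ω (AdjoinSimple.gen F α))))))
  rw [θ.apply_symm_apply, θ.apply_symm_apply]

end Polynomial

section Rational

variable {n : ℕ} {G : Subgroup (Equiv.Perm (Fin n))} {p : ℚ[X]}
  [Fact ((p.map (algebraMap ℚ ℂ)).Splits)]

/-- A polynomial whose Galois group acts transitively on its roots, and which has as many roots as
its degree, is the minimal polynomial of each of them. -/
theorem minpoly_eq_of_isPretransitive (hG : MulAction.IsPretransitive G (Fin n)) (hpm : p.Monic)
    (hpn : p.natDegree = n) (hp : IsPermIsomorphic (Gal.galActionHom p ℂ) G) {α : ℂ}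
    (hα : α ∈ p.rootSet ℂ) : minpoly ℚ α = p := by
  obtain ⟨φ, ψ, hφ⟩ := hp
  have hint : IsIntegral ℚ α := ⟨p, hpm, (mem_rootSet.mp hα).2⟩
  have hsub : p.rootSet ℂ ⊆ (minpoly ℚ α).rootSet ℂ := by
    intro β hβ
    obtain ⟨g, hg⟩ := hG.exists_smul_eq (φ ⟨α, hα⟩) (φ ⟨β, hβ⟩)
    have h1 := hφ (ψ.symm g) ⟨α, hα⟩
    rw [ψ.apply_symm_apply] at h1
    have h2 : Gal.galActionHom p ℂ (ψ.symm g) ⟨α, hα⟩ = ⟨β, hβ⟩ := φ.injective (h1.trans hg)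
    obtain ⟨s, hs⟩ := exists_algebraMap_splittingField_eq (⟨α, hα⟩ : p.rootSet ℂ)
    have h3 : β = algebraMap p.SplittingField ℂ (ψ.symm g s) := by
      rw [← coe_galActionHom_apply _ hs, h2]
    have h4 : aeval s (minpoly ℚ α) = 0 := by
      apply (algebraMap p.SplittingField ℂ).injective
      rw [← aeval_algebraMap_apply, hs, map_zero, minpoly.aeval]
    rw [mem_rootSet]
    refine ⟨minpoly.ne_zero hint, ?_⟩
    rw [h3, aeval_algebraMap_apply]
    have h5 : aeval (ψ.symm g s) (minpoly ℚ α) = ψ.symm g (aeval s (minpoly ℚ α)) :=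
      aeval_algHom_apply (AlgEquiv.toAlgHom (ψ.symm g)) s _
    rw [h5, h4, map_zero, map_zero]
  have hcard : n ≤ (minpoly ℚ α).natDegree := by
    calc n = Nat.card (p.rootSet ℂ) := by rw [Nat.card_congr φ]; simp
      _ = (p.rootSet ℂ).ncard := rfl
      _ ≤ ((minpoly ℚ α).rootSet ℂ).ncard := Set.ncard_le_ncard hsub (rootSet_finite _ _)
      _ ≤ _ := ncard_rootSet_le _ _
  refine (eq_of_monic_of_dvd_of_natDegree_le (minpoly.monic hint) hpm
    (minpoly.dvd ℚ α (mem_rootSet.mp hα).2) ?_).symm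
  rwa [hpn]

theorem fieldHasGaloisGroup_adjoin (hp : IsPermIsomorphic (Gal.galActionHom p ℂ) G) {α : ℂ}
    (hint : IsIntegral ℚ α) (hα : minpoly ℚ α = p) :
    FieldHasGaloisGroup (IntermediateField.adjoin ℚ {α}) G := by
  obtain ⟨a, b, hab⟩ := exists_equiv_embeddings_rootSet hint hα
  exact IsPermIsomorphic.of_equiv hp a b hab

end Rational

end Galois

/-! ### Summation over the fields -/

section Count

open NumberField

theorem fieldCount_mono {n : ℕ} {G : Subgroup (Equiv.Perm (Fin n))} {X Y : ℝ} (h : X ≤ Y) :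
    fieldCount n G X ≤ fieldCount n G Y :=
  Set.ncard_le_ncard (Set.image_mono fun _ ⟨hK, h1, h2, h3⟩ => ⟨hK, h1, h2, h3.trans h⟩)
    ((galoisFields_finite n G Y).image _)

/-- The bound for the number of fields with large `X`, extended to `1 ≤ X` by monotonicity. -/
theorem exists_forall_fieldCount_le {n : ℕ} {G : Subgroup (Equiv.Perm (Fin n))} {e : ℝ}
    (hN : ∃ C X₀ : ℝ, ∀ X : ℝ, X₀ ≤ X → (fieldCount n G X : ℝ) ≤ C * X ^ e) :
    ∃ C : ℝ, 0 ≤ C ∧ ∀ X : ℝ, 1 ≤ X → (fieldCount n G X : ℝ) ≤ C * X ^ e := by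
  obtain ⟨C, X₀, hC⟩ := hN
  refine ⟨max C 0 * max X₀ 1 ^ e, by positivity, fun X hX => ?_⟩
  have h1 : 1 ≤ max X₀ 1 := le_max_right _ _
  have h2 : X ≤ max X₀ 1 * X := le_mul_of_one_le_left (by linarith) h1
  have h3 : X₀ ≤ max X₀ 1 * X :=
    (le_max_left X₀ 1).trans (le_mul_of_one_le_right (by linarith) hX)
  calc (fieldCount n G X : ℝ) ≤ fieldCount n G (max X₀ 1 * X) := by
        exact_mod_cast fieldCount_mono h2
    _ ≤ C * (max X₀ 1 * X) ^ e := hC _ h3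
    _ ≤ max C 0 * (max X₀ 1 * X) ^ e := by gcongr; exact le_max_left _ _
    _ = _ := by rw [Real.mul_rpow (by linarith) (by linarith)]; ring

/-- Partial summation: if at most `C * X ^ e` of the `D c` are at most `X`, then the sum of
`D c ^ (-θ)` over `D c ≤ Y` is `O(Y ^ (e - θ))`. The proof is by halving `Y`. -/
theorem sum_rpow_neg_le {ι : Type*} {I : Finset ι} {D : ι → ℝ} {C e θ : ℝ} (hC : 0 ≤ C)
    (hθ : 0 ≤ θ) (he : θ < e) (hD : ∀ c ∈ I, 1 ≤ D c)
    (hcount : ∀ X : ℝ, 1 ≤ X → ((I.filter fun c => D c ≤ X).card : ℝ) ≤ C * X ^ e)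
    {Y : ℝ} (hY : 0 < Y) :
    ∑ c ∈ I with D c ≤ Y, D c ^ (-θ) ≤ C * 2 ^ θ / (1 - 2 ^ (-(e - θ))) * Y ^ (e - θ) := by
  set r : ℝ := 2 ^ (-(e - θ)) with hr
  have hr1 : r < 1 := Real.rpow_lt_one_of_one_lt_of_neg one_lt_two (by linarith)
  set A : ℝ := C * 2 ^ θ / (1 - r) with hA
  have hr1' : 0 < 1 - r := by linarith
  have hA0 : 0 ≤ A := by positivity
  have hAr : A * r + C * 2 ^ θ = A := by rw [hA]; field_simp; ring
  obtain ⟨k, hk⟩ := pow_unbounded_of_one_lt Y one_lt_two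
  induction k generalizing Y with
  | zero =>
    rw [Finset.sum_eq_zero]
    · positivity
    · intro c hc
      rw [Finset.mem_filter] at hc
      have := hD c hc.1
      rw [pow_zero] at hk
      linarith
  | succ k ih =>
    rcases lt_or_ge Y 1 with hY1 | hY1
    · rw [Finset.sum_eq_zero]
      · positivity
      · intro c hc
        rw [Finset.mem_filter] at hc
        have := hD c hc.1
        linarith
    have ih' := ih (Y := Y / 2) (by positivity) (by rw [pow_succ] at hk; linarith)
    have hsplit : ∑ c ∈ I with D c ≤ Y, D c ^ (-θ) ≤
        ∑ c ∈ I with D c ≤ Y / 2, D c ^ (-θ) + ∑ c ∈ I with D c ≤ Y, (Y / 2) ^ (-θ) := by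
      simp only [Finset.sum_filter]
      rw [← Finset.sum_add_distrib]
      refine Finset.sum_le_sum fun c hc => ?_
      have hDc := hD c hc
      have h1 : 0 ≤ D c ^ (-θ) := by positivity
      have h2 : 0 ≤ (Y / 2) ^ (-θ) := by positivity
      by_cases h3 : D c ≤ Y / 2
      · have h4 : D c ≤ Y := by linarith
        simp [h3, h4, h2]
      · by_cases h4 : D c ≤ Y
        · simp only [h3, h4, if_true, if_false, zero_add]
          exact Real.rpow_le_rpow_of_nonpos (by positivity) (not_le.mp h3).le (by linarith)
        · simp [h3, h4]
    rw [Finset.sum_const, nsmul_eq_mul] at hsplit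
    have h1 : (Y / 2) ^ (e - θ) = r * Y ^ (e - θ) := by
      rw [Real.div_rpow hY.le zero_le_two, hr, Real.rpow_neg zero_le_two]; field_simp
    have h2 : ((I.filter fun c => D c ≤ Y).card : ℝ) * (Y / 2) ^ (-θ) ≤
        C * 2 ^ θ * Y ^ (e - θ) := by
      calc _ ≤ C * Y ^ e * (Y / 2) ^ (-θ) := by gcongr; exact hcount Y hY1
        _ = _ := by
          rw [Real.div_rpow hY.le zero_le_two, Real.rpow_neg zero_le_two, Real.rpow_neg hY.le,
            Real.rpow_sub hY]
          field_simp
    calc _ ≤ A * (r * Y ^ (e - θ)) + C * 2 ^ θ * Y ^ (e - θ) := by rw [← h1]; linarith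
      _ = (A * r + C * 2 ^ θ) * Y ^ (e - θ) := by ring
      _ = _ := by rw [hAr]

/-- A polynomial with transitive Galois group `G` is the minimal polynomial of an integral generator
of a field with Galois group `G`. -/
theorem exists_rootField {n : ℕ} (hn : n ≠ 0) {G : Subgroup (Equiv.Perm (Fin n))}
    (hG : MulAction.IsPretransitive G (Fin n)) {f : ℤ[X]} (hfm : f.Monic) (hfn : f.natDegree = n)
    (hf : PolyHasGaloisGroup f G) :
    ∃ K : IntermediateField ℚ ℂ, ∃ _ : NumberField K, finrank ℚ K = n ∧ FieldHasGaloisGroup K G ∧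
      ∃ x : 𝓞 K, minpoly ℚ (x : K) = f.map (Int.castRingHom ℚ) := by
  have : Fact (((f.map (Int.castRingHom ℚ)).map (algebraMap ℚ ℂ)).Splits) :=
    ⟨IsAlgClosed.splits _⟩
  set p := f.map (Int.castRingHom ℚ) with hp
  have hpm : p.Monic := hfm.map _
  have hpn : p.natDegree = n := by rw [hp, hfm.natDegree_map, hfn]
  obtain ⟨α, hα⟩ : (p.rootSet ℂ).Nonempty := by
    obtain ⟨φ, -, -⟩ := id hf
    exact ⟨_, (φ.symm ⟨0, Nat.pos_of_ne_zero hn⟩).2⟩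
  have hmin := minpoly_eq_of_isPretransitive hG hpm hpn hf hα
  have hint : IsIntegral ℚ α := ⟨p, hpm, (mem_rootSet.mp hα).2⟩
  have hfin : finrank ℚ (IntermediateField.adjoin ℚ {α}) = n := by
    rw [IntermediateField.adjoin.finrank hint, hmin, hpn]
  have hgen : minpoly ℚ (IntermediateField.AdjoinSimple.gen ℚ α) = p :=
    (IntermediateField.minpoly_gen ℚ α).trans hmin
  have hgint : IsIntegral ℤ (IntermediateField.AdjoinSimple.gen ℚ α) := by
    refine ⟨f, hfm, ?_⟩
    have := minpoly.aeval ℚ (IntermediateField.AdjoinSimple.gen ℚ α)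
    rw [hgen, hp, aeval_def, eval₂_map] at this
    convert! this using 2
  refine ⟨IntermediateField.adjoin ℚ {α},
    { to_charZero := inferInstance, to_finiteDimensional := .of_finrank_pos (by omega) }, hfin,
    fieldHasGaloisGroup_adjoin hf hint hmin, ⟨_, hgint⟩, hgen⟩

theorem exists_minpoly_eq_of_algEquiv {K L : Type*} [Field K] [NumberField K] [Field L]
    [NumberField L] (g : K ≃ₐ[ℚ] L) (x : 𝓞 K) :
    ∃ y : 𝓞 L, minpoly ℚ (y : L) = minpoly ℚ (x : K) :=
  ⟨⟨g x, x.isIntegral_coe.map g⟩, minpoly.algEquiv_eq g (x : K)⟩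

/-- The polynomials are grouped by the isomorphism class of their root field. In each class a
representative `K` is chosen, and the polynomials of the class are counted as minimal polynomials of
integers of `K`. -/
theorem polyCount_le_of_two_pow {n : ℕ} (hn : 2 ≤ n) {G : Subgroup (Equiv.Perm (Fin n))}
    (hG : MulAction.IsPretransitive G (Fin n)) {e θ C A : ℝ} (hθ : 0 ≤ θ) (he : θ < e) (hC : 0 ≤ C)
    (hA : 0 ≤ A) (hN : ∀ X : ℝ, 1 ≤ X → (fieldCount n G X : ℝ) ≤ C * X ^ e) {m : ℕ}
    (hK : ∀ (K : IntermediateField ℚ ℂ) [NumberField K], finrank ℚ K = n →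
      FieldHasGaloisGroup K G → ∀ s : Finset (𝓞 K),
      (∀ x ∈ s, ∏ σ : K →+* ℂ, max 1 ‖σ x‖ ≤ 2 ^ m) →
      (∀ x ∈ s, Function.Injective fun σ : K →+* ℂ => σ x) →
      (s.card : ℝ) ≤ A * ((|discr K| : ℤ) : ℝ) ^ (-θ))
    {B : ℝ} (hB : √(n + 1) * B ≤ 2 ^ m) :
    (polyCount n G B : ℝ) ≤ A * (C * 2 ^ θ / (1 - 2 ^ (-(e - θ))) *
      (2 ^ (n * (n - 1)) * (2 ^ m) ^ (2 * (n - 1))) ^ (e - θ)) := by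
  classical
  have : Finite (galoisPolys n G B) := galoisPolys_finite n G B
  have : Fintype (galoisPolys n G B) := Fintype.ofFinite _
  choose K hNF hfin hgal x hx using fun f : galoisPolys n G B =>
    exists_rootField (by omega) hG f.2.1 f.2.2.1 f.2.2.2.2
  have hbound : ∀ (f : galoisPolys n G B) {L : Type} [Field L] [NumberField L] (y : 𝓞 L),
      finrank ℚ L = n → minpoly ℚ (y : L) = f.1.map (Int.castRingHom ℚ) →
      ∏ σ : L →+* ℂ, max 1 ‖σ y‖ ≤ 2 ^ m := fun f L _ _ y hL hy =>
    (prod_max_one_le_supNorm hL f.2.1 f.2.2.1 hy).trans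
      (hB.trans' (by gcongr; exact f.2.2.2.1))
  let cl : galoisPolys n G B → Quotient fieldIsoSetoid := fun f => Quotient.mk _ (K f)
  have hr1 : (2 : ℝ) ^ (-(e - θ)) < 1 :=
    Real.rpow_lt_one_of_one_lt_of_neg one_lt_two (by linarith)
  have hr1' : 0 < 1 - (2 : ℝ) ^ (-(e - θ)) := by linarith
  rcases isEmpty_or_nonempty (galoisPolys n G B) with hemp | hne
  · have : polyCount n G B = 0 := by
      rw [polyCount, ← Nat.card_coe_set_eq, Nat.card_of_isEmpty]
    rw [this, Nat.cast_zero]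
    positivity
  let r : Quotient fieldIsoSetoid → galoisPolys n G B := Function.invFun cl
  let I := Finset.univ.image cl
  have hr : ∀ c ∈ I, cl (r c) = c := fun c hc => by
    obtain ⟨f, -, hf⟩ := Finset.mem_image.mp hc
    exact Function.invFun_eq ⟨f, hf⟩
  let D : Quotient fieldIsoSetoid → ℝ := fun c => ((|discr (K (r c))| : ℤ) : ℝ)
  set Y : ℝ := 2 ^ (n * (n - 1)) * (2 ^ m) ^ (2 * (n - 1)) with hY
  have hinj : ∀ f, Function.Injective fun σ : K f →+* ℂ => σ (x f) := fun f =>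
    injective_embeddings_of_minpoly_eq (hfin f) f.2.1 f.2.2.1 (hx f)
  have hDY : ∀ c, D c ≤ Y := fun c =>
    discr_le_of_prod_max_one_le (hfin _) (hinj _) (hbound _ _ (hfin _) (hx _))
  have hfiber : ∀ c ∈ I, ((Finset.univ.filter fun f => cl f = c).card : ℝ) ≤ A * D c ^ (-θ) := by
    intro c hc
    have hex : ∀ f : galoisPolys n G B, cl f = c →
        ∃ y : 𝓞 (K (r c)), minpoly ℚ (y : K (r c)) = f.1.map (Int.castRingHom ℚ) := fun f hf => by
      obtain ⟨g⟩ : Nonempty (K f ≃ₐ[ℚ] K (r c)) := Quotient.exact (hf.trans (hr c hc).symm)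
      obtain ⟨y, hy⟩ := exists_minpoly_eq_of_algEquiv g (x f)
      exact ⟨y, hy.trans (hx f)⟩
    choose! y hy using hex
    have hyinj : Set.InjOn y (Finset.univ.filter fun f => cl f = c : Finset _) := by
      intro f hf f' hf' h
      have hf := (Finset.mem_filter.mp hf).2
      have hf' := (Finset.mem_filter.mp hf').2
      refine Subtype.ext (map_injective (Int.castRingHom ℚ) Int.cast_injective ?_)
      rw [← hy f hf, ← hy f' hf', h]
    rw [← Finset.card_image_of_injOn hyinj]
    refine hK (K (r c)) (hfin _) (hgal _) _ (fun z hz => ?_) fun z hz => ?_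
    · obtain ⟨f, hf, rfl⟩ := Finset.mem_image.mp hz
      exact hbound f _ (hfin _) (hy f (Finset.mem_filter.mp hf).2)
    · obtain ⟨f, hf, rfl⟩ := Finset.mem_image.mp hz
      exact injective_embeddings_of_minpoly_eq (hfin _) f.2.1 f.2.2.1
        (hy f (Finset.mem_filter.mp hf).2)
  have hcount : ∀ X : ℝ, 1 ≤ X → ((I.filter fun c => D c ≤ X).card : ℝ) ≤ C * X ^ e := by
    intro X hX
    refine (Nat.cast_le.mpr ?_).trans (hN X hX)
    rw [fieldCount, ← Set.ncard_coe_finset]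
    refine Set.ncard_le_ncard (fun c hc => ?_) ((galoisFields_finite n G X).image _)
    have hc := Finset.mem_filter.mp hc
    exact ⟨K (r c), ⟨hNF _, hfin _, hgal _, hc.2⟩, hr c hc.1⟩
  have hsum := sum_rpow_neg_le hC hθ he (fun c _ =>
    show (1 : ℝ) ≤ ((|discr (K (r c))| : ℤ) : ℝ) by
      exact_mod_cast Int.one_le_abs (discr_ne_zero (K (r c)))) hcount (Y := Y) (by positivity)
  rw [Finset.filter_true_of_mem fun c _ => hDY c] at hsum
  have hcard : polyCount n G B = ∑ c ∈ I, (Finset.univ.filter fun f => cl f = c).card := by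
    rw [← Finset.card_eq_sum_card_image, polyCount, ← Nat.card_coe_set_eq,
      Nat.card_eq_fintype_card, Finset.card_univ]
  calc (polyCount n G B : ℝ) = ∑ c ∈ I, ((Finset.univ.filter fun f => cl f = c).card : ℝ) := by
        rw [hcard]; push_cast; rfl
    _ ≤ ∑ c ∈ I, A * D c ^ (-θ) := Finset.sum_le_sum hfiber
    _ = A * ∑ c ∈ I, D c ^ (-θ) := by rw [Finset.mul_sum]
    _ ≤ _ := by gcongr

/-- If the number of integral generators of Mahler measure at most `2 ^ m` saves a factor `|discr K|
^ θ`, then so does the number of polynomials with `|discr K|` replaced by the order of its maximum,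
`B ^ (2 * n - 2)`. -/
theorem exists_polyCount_le {n : ℕ} (hn : 2 ≤ n) {G : Subgroup (Equiv.Perm (Fin n))}
    (hG : MulAction.IsPretransitive G (Fin n)) {e θ : ℝ} (hθ : 0 ≤ θ) (he : θ < e)
    (hN : ∃ C X₀ : ℝ, ∀ X : ℝ, X₀ ≤ X → (fieldCount n G X : ℝ) ≤ C * X ^ e)
    (hK : ∀ (K : IntermediateField ℚ ℂ) [NumberField K], finrank ℚ K = n →
      FieldHasGaloisGroup K G → ∀ (m : ℕ) (s : Finset (𝓞 K)),
      (∀ x ∈ s, ∏ σ : K →+* ℂ, max 1 ‖σ x‖ ≤ 2 ^ m) →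
      (∀ x ∈ s, Function.Injective fun σ : K →+* ℂ => σ x) →
      (s.card : ℝ) ≤ (16 * n.factorial) ^ n * 2 ^ (m + n) * (m + n + 1) ^ (n - 1) *
        ((|discr K| : ℤ) : ℝ) ^ (-θ)) :
    ∃ C : ℝ, ∀ B : ℝ, 2 ≤ B →
      (polyCount n G B : ℝ) ≤ C * (B ^ ((2 * n - 2) * (e - θ) + 1) * Real.log B ^ (n - 1)) := by
  obtain ⟨C, hC, hN⟩ := exists_forall_fieldCount_le hN
  set S : ℝ := √(n + 1) with hS
  have hS1 : 1 ≤ S := Real.one_le_sqrt.mpr (by linarith [n.cast_nonneg (α := ℝ)])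
  have hl2 : 0 < Real.log 2 := Real.log_pos one_lt_two
  set c : ℝ := (Real.log (2 * S) / Real.log 2 + n + 2) / Real.log 2 with hc
  have hlS : 0 ≤ Real.log (2 * S) := Real.log_nonneg (by linarith)
  set Q : ℝ := C * 2 ^ θ / (1 - 2 ^ (-(e - θ))) with hQ
  have hQ0 : 0 ≤ Q := by
    have : (2 : ℝ) ^ (-(e - θ)) < 1 :=
      Real.rpow_lt_one_of_one_lt_of_neg one_lt_two (by linarith)
    have : 0 < 1 - (2 : ℝ) ^ (-(e - θ)) := by linarith
    positivity
  refine ⟨(16 * n.factorial) ^ n * (2 ^ (n + 1) * S) * c ^ (n - 1) *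
    (Q * (2 ^ (n * (n - 1)) * (2 * S) ^ (2 * (n - 1))) ^ (e - θ)), fun B hB => ?_⟩
  have hB0 : 0 < B := by linarith
  -- The Mahler measure is at most `S * B ≤ 2 ^ (k + 1) ≤ 2 * S * B`.
  obtain ⟨k, hk1, hk2⟩ := exists_nat_pow_near (x := S * B) (by nlinarith) (one_lt_two (α := ℝ))
  have hm2 : (2 : ℝ) ^ (k + 1) ≤ 2 * S * B := by rw [pow_succ]; linarith
  have hlB : Real.log 2 ≤ Real.log B := Real.log_le_log two_pos hB
  have hlog : (((k + 1 : ℕ) : ℝ) + n + 1) ≤ c * Real.log B := by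
    have h1 : ((k + 1 : ℕ) : ℝ) * Real.log 2 ≤ Real.log (2 * S) + Real.log B := by
      rw [← Real.log_pow, ← Real.log_mul (by positivity) (by positivity)]
      exact Real.log_le_log (by positivity) hm2
    have h2 : ((k + 1 : ℕ) : ℝ) ≤ Real.log (2 * S) / Real.log 2 + Real.log B / Real.log 2 := by
      rw [← add_div, le_div_iff₀ hl2]; exact h1
    have h3 : 1 ≤ Real.log B / Real.log 2 := (one_le_div hl2).mpr hlB
    have h4 : c * Real.log B =
        (Real.log (2 * S) / Real.log 2 + n + 2) * (Real.log B / Real.log 2) := by rw [hc]; ring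
    rw [h4]
    have h5 : 0 ≤ Real.log (2 * S) / Real.log 2 + n + 1 := by positivity
    nlinarith
  have hc0 : 0 ≤ c := by positivity
  have hlB0 : 0 ≤ Real.log B := hl2.le.trans hlB
  have key := polyCount_le_of_two_pow hn hG hθ he hC (m := k + 1)
    (A := (16 * n.factorial) ^ n * 2 ^ (k + 1 + n) * (((k + 1 : ℕ) : ℝ) + n + 1) ^ (n - 1))
    (by positivity) hN (fun K _ h1 h2 s h3 h4 => hK K h1 h2 (k + 1) s h3 h4) hk2.le
  refine key.trans ?_
  have hn1 : ((2 * (n - 1) : ℕ) : ℝ) = 2 * n - 2 := by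
    rw [Nat.cast_mul, Nat.cast_sub (by omega)]; push_cast; ring
  have hpow : (2 ^ (n * (n - 1)) * (2 ^ (k + 1)) ^ (2 * (n - 1)) : ℝ) ^ (e - θ) ≤
      (2 ^ (n * (n - 1)) * (2 * S) ^ (2 * (n - 1))) ^ (e - θ) * B ^ ((2 * n - 2) * (e - θ)) := by
    rw [← hn1, Real.rpow_mul hB0.le, Real.rpow_natCast,
      ← Real.mul_rpow (by positivity) (by positivity), mul_assoc, ← mul_pow]
    refine Real.rpow_le_rpow (by positivity) ?_ (by linarith)
    gcongr
  have h2B : (2 : ℝ) ^ (k + 1 + n) ≤ 2 ^ (n + 1) * S * B := by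
    rw [pow_add, pow_succ 2 n]
    nlinarith [show (0 : ℝ) < 2 ^ n by positivity]
  calc _ ≤ (16 * n.factorial) ^ n * (2 ^ (n + 1) * S * B) * (c * Real.log B) ^ (n - 1) *
        (Q * ((2 ^ (n * (n - 1)) * (2 * S) ^ (2 * (n - 1))) ^ (e - θ) *
          B ^ ((2 * n - 2) * (e - θ)))) := by gcongr
    _ = _ := by rw [Real.rpow_add hB0, Real.rpow_one, mul_pow c]; ring

end Count

theorem theorem3 (n : ℕ) (hn : 2 ≤ n) (G : Subgroup (Equiv.Perm (Fin n)))
    (hG : MulAction.IsPretransitive G (Fin n))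
    (e : ℝ) (he : 1 / ((n : ℝ) ^ 2 - n) < e)
    (hN : ∃ C X₀ : ℝ, ∀ X : ℝ, X₀ ≤ X → (fieldCount n G X : ℝ) ≤ C * X ^ e) :
    (∃ C : ℝ, ∀ B : ℝ, 2 ≤ B →
      (polyCount n G B : ℝ) ≤ C * (B ^ (e * (2 * n - 2) + 1) * Real.log B ^ (n - 1))) ∧
    (MulAction.IsPreprimitive G (Fin n) →
      ∃ C : ℝ, ∀ B : ℝ, 2 ≤ B →
        (polyCount n G B : ℝ) ≤
          C * (B ^ (e * (2 * n - 2) + 1 - 2 / n) * Real.log B ^ (n - 1))) := by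
  have hn' : (2 : ℝ) ≤ n := by exact_mod_cast hn
  have hnn : 0 < (n : ℝ) ^ 2 - n := by nlinarith
  have hκ : 0 < 1 / ((n : ℝ) ^ 2 - n) := by positivity
  constructor
  · have key := exists_polyCount_le hn hG le_rfl (hκ.trans he) hN
      fun K _ hfin _ m s hs _ => by
        rw [neg_zero, Real.rpow_zero, mul_one]
        exact card_le_of_mahler_le hfin hs
    rwa [show (2 * (n : ℝ) - 2) * (e - 0) + 1 = e * (2 * n - 2) + 1 by ring] at key
  · intro hprim
    have key := exists_polyCount_le hn hG hκ.le he hN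
      fun K _ hfin hgal m s hs hs' => card_le_of_primitive_of_mahler_le hfin hn
        (hgal.exists_int_or_injective hprim) hs hs'
    rwa [show (2 * (n : ℝ) - 2) * (e - 1 / ((n : ℝ) ^ 2 - n)) + 1 =
      e * (2 * n - 2) + 1 - 2 / n by
        have : (n : ℝ) ≠ 0 := by positivity
        have : (n : ℝ) - 1 ≠ 0 := by linarith
        rw [show (n : ℝ) ^ 2 - n = n * (n - 1) by ring]
        field_simp
        ring] at key
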